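/- Let $\widehat{\mathbb C}=\mathbb C\cup\{\infty\}$. For a finite set $\alpha\subseteq\widehat{\mathbb C}$ let $\mathcal A_\alpha$ be the group of all Möbius transformations $f$ with $f(\alpha)=\alpha$. For $n\ge 2$ let $G_n=\langle z\mapsto e^{2\pi i/n}z\rangle$, whose orbits are $\{\infty\}$, $\{0\}$ and $C_n(z)=\{e^{2\pi i j/n}z : j\in\mathbb Z\}$ for $z\in\mathbb C^*$. If $\alpha$ is a finite union of orbits of $G_n$, its cyclic-$n$ component index is the pair $(\nu,k)\in\{0,1,2\}\times\mathbb N$, where $\nu$ is the number of the orbits $\{\infty\},\{0\}$ contained in $\alpha$ and $k$ is the number of orbits $C_n(z)$, $z\in\mathbb C^*$, contained in $\alpha$. If $\mathcal A_\alpha\simeq\mathbb Z_n$, the component index of $\alpha$ is defined as that of $\varphi(\alpha)$, where $\varphi$ is a Möbius transformation with $\mathcal A_{\varphi(\alpha)}=G_n$. Theorem. Let $n\ge2$. (1) For every finite $\alpha$ with $\mathcal A_\alpha\simeq\mathbb Z_n$ such a $\varphi$ exists, the component index $(\nu,k)$ of $\alpha$ does not depend on the choice of $\varphi$, and $|\alpha|=\nu+nk$.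 (2) Let $(\nu,k)\in\{0,1,2\}\times\mathbb N$. There is a finite $\alpha$ with $\mathcal A_\alpha\simeq\mathbb Z_n$ and component index $(\nu,k)$ if and only if one of the following holds: $k\ge3$; or $(\nu,k)=(1,2)$; or $n\ge4$ and $(\nu,k)=(1,1)$. The same equivalence holds with $\mathcal A_\alpha\simeq\mathbb Z_n$ replaced by $\mathcal A_\alpha=G_n$. (3) The set of possible sizes is $$\{|\alpha|<\infty : \mathcal A_\alpha\simeq\mathbb Z_n\}=\{x+nk : x\in\{0,1,2\},\ k\ge3\}\cup\{1+n,\,1+2n\}\quad\text{if } n\ge4,$$ $$\{|\alpha|<\infty : \mathcal A_\alpha\simeq\mathbb Z_n\}=\{x+nk : x\in\{0,1,2\},\ k\ge3\}\cup\{1+2n\}\quad\text{if } n=2,3.$$ (4) For $n=2$ and every $k\ge2$, the set $\alpha=\{0,\pm1,\pm2,\dots,\pm k\}$ has $\mathcal A_\alpha=\langle z\mapsto -z\rangle=G_2$ and component index $(1,k)$. -/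

import Mathlib

open scoped Pointwise Matrix

noncomputable section

/-- The Riemann sphere `ℂ ∪ {∞}`. -/
abbrev Sphere : Type := OnePoint ℂ

/-- The group of all Möbius transformations `z ↦ (a z + b) / (c z + d)`, `a d - b c ≠ 0`,
as a group of bijections of the Riemann sphere. -/
def moebiusGroup : Subgroup (Equiv.Perm Sphere) :=
  (MulAction.toPermHom (GL (Fin 2) ℂ) Sphere).range

/-- The stabilizer of `α`: all Möbius transformations `f` with `f(α) = α`. -/
def moebiusStabilizer (α : Set Sphere) : Subgroup moebiusGroup :=
  MulAction.stabilizer moebiusGroup α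

/-- The root of unity `exp (2 π i / n)`. -/
def rootOfUnity (n : ℕ) : ℂ := Complex.exp (2 * Real.pi * Complex.I / n)

/-- The Möbius transformation `z ↦ exp (2 π i / n) z`. -/
def moebiusRotation (n : ℕ) : moebiusGroup :=
  (MulAction.toPermHom (GL (Fin 2) ℂ) Sphere).rangeRestrict
    (Matrix.GeneralLinearGroup.mkOfDetNeZero !![rootOfUnity n, 0; 0, 1]
      (by simp [rootOfUnity, Complex.exp_ne_zero]))

theorem moebiusRotation_smul_coe (n : ℕ) (z : ℂ) :
    moebiusRotation n • (z : Sphere) = ((rootOfUnity n * z : ℂ) : Sphere) := by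
  change (Matrix.GeneralLinearGroup.mkOfDetNeZero !![rootOfUnity n, 0; 0, 1] _ :
    GL (Fin 2) ℂ) • (z : Sphere) = _
  simp [OnePoint.smul_some_eq_ite, Matrix.GeneralLinearGroup.mkOfDetNeZero]

theorem moebiusRotation_smul_infty (n : ℕ) :
    moebiusRotation n • (OnePoint.infty : Sphere) = OnePoint.infty := by
  change (Matrix.GeneralLinearGroup.mkOfDetNeZero !![rootOfUnity n, 0; 0, 1] _ :
    GL (Fin 2) ℂ) • (OnePoint.infty : Sphere) = _
  simp [OnePoint.smul_infty_eq_ite, Matrix.GeneralLinearGroup.mkOfDetNeZero]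

/-- The standard cyclic group of order `n`, generated by `z ↦ exp (2 π i / n) z`. -/
def rotationGroup (n : ℕ) : Subgroup moebiusGroup := Subgroup.zpowers (moebiusRotation n)

/-- The orbit `C_n(z) = {exp (2 π i j / n) z : j ∈ ℤ}`. -/
def cyclicOrbit (n : ℕ) (z : ℂ) : Set Sphere :=
  {w | ∃ j : ℤ, w = ((rootOfUnity n ^ j * z : ℂ) : Sphere)}

/-- The cyclic-`n` component index `(ν, k)` of a finite union `α` of orbits of `rotationGroup n`:
`ν` is the number of the orbits `{∞}`, `{0}` in `α`, and `k` is the number of orbits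
`C_n(z)`, `z ≠ 0`, in `α`. -/
def cyclicIndex (n : ℕ) (α : Set Sphere) : ℕ × ℕ :=
  ({o : Set Sphere | (o = {OnePoint.infty} ∨ o = {((0 : ℂ) : Sphere)}) ∧ o ⊆ α}.ncard,
   {o : Set Sphere | (∃ z : ℂ, z ≠ 0 ∧ o = cyclicOrbit n z) ∧ o ⊆ α}.ncard)

/-- `α` has cyclic-`n` component index `p`: after a Möbius change of coordinate `φ` that makes the
stabilizer equal to the standard group `rotationGroup n`, the index is `p`. -/
def HasCyclicIndex (n : ℕ) (α : Set Sphere) (p : ℕ × ℕ) : Prop :=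
  ∃ φ : moebiusGroup,
    moebiusStabilizer (φ • α) = rotationGroup n ∧ cyclicIndex n (φ • α) = p

/-- The set `{0, ±1, …, ±k}`. -/
def symmetricIntegers (k : ℕ) : Set Sphere :=
  {w | ∃ j : ℤ, |j| ≤ (k : ℤ) ∧ w = ((j : ℂ) : Sphere)}

end

/-! A nontrivial Möbius transformation of finite order has a fixed point; with that point at ∞ it is
affine and not a translation, hence conjugate to a dilation by a root of unity. So a stabilizer
isomorphic to ℤ/n is conjugate to G_n. The G_n-invariant sets are `rotSet n E S`: a set E of poles
together with the solutions of z^n ∈ S. The index is (|E|, |S|) and the size |E| + n|S|. Two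
normalizations differ by a map carrying G_n to itself, which preserves {0, ∞}; so ν is well defined,
and k follows by counting.

The excluded indices have explicit extra symmetries: every dilation if k = 0; an inversion z ↦ e/z
if ν ≠ 1 and k ≤ 2; for ν = k = 1 and n ≤ 3, a map exchanging the pole with a point of the orbit.

For existence, S is put on the unit circle. If n|S| ≥ |E| + 3, a symmetry sends three circle points
to circle points, so it preserves the circle, and therefore E. If E = {0} it is a dilation; if E =
{0, ∞} it is a dilation or an inversion. If E is empty, poles give no information, and invariance of
the product of all distances between points of α is used instead: it forces c d = 0, as equality in
the reverse triangle inequality cannot hold for two different s ∈ S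
(`eq_zero_or_eq_zero_of_maps_circle`). Finally S = {exp(ij) : j ∈ J} is chosen with J admitting no
nonzero translation and, where inversions matter, no reflection.

For {0, ±1, …, ±k} a non-affine symmetry would put the integer points (j, g j) on a hyperbola, whose
strict convexity contradicts surjectivity of g. -/

/-! ### Möbius transformations in coordinates -/

/-- The Möbius transformation `z ↦ (a z + b) / (c z + d)`. -/
noncomputable def mob (a b c d : ℂ) (h : a * d - b * c ≠ 0) : moebiusGroup :=
  (MulAction.toPermHom (GL (Fin 2) ℂ) Sphere).rangeRestrict
    (Matrix.GeneralLinearGroup.mkOfDetNeZero !![a, b; c, d]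
      (by simpa [Matrix.det_fin_two] using h))

open Classical in
theorem mob_smul_coe {a b c d : ℂ} (h : a * d - b * c ≠ 0) (z : ℂ) :
    mob a b c d h • (z : Sphere) =
      if c * z + d = 0 then OnePoint.infty else (((a * z + b) / (c * z + d) : ℂ) : Sphere) := by
  change (Matrix.GeneralLinearGroup.mkOfDetNeZero !![a, b; c, d] _ :
    GL (Fin 2) ℂ) • (z : Sphere) = _
  simp [OnePoint.smul_some_eq_ite, Matrix.GeneralLinearGroup.mkOfDetNeZero]

open Classical in
theorem mob_smul_infty {a b c d : ℂ} (h : a * d - b * c ≠ 0) :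
    mob a b c d h • (OnePoint.infty : Sphere) =
      if c = 0 then OnePoint.infty else ((a / c : ℂ) : Sphere) := by
  change (Matrix.GeneralLinearGroup.mkOfDetNeZero !![a, b; c, d] _ :
    GL (Fin 2) ℂ) • (OnePoint.infty : Sphere) = _
  simp [OnePoint.smul_infty_eq_ite, Matrix.GeneralLinearGroup.mkOfDetNeZero]

theorem mob_smul_coe_of_ne {a b c d : ℂ} (h : a * d - b * c ≠ 0) {z : ℂ} (hz : c * z + d ≠ 0) :
    mob a b c d h • (z : Sphere) = (((a * z + b) / (c * z + d) : ℂ) : Sphere) := by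
  rw [mob_smul_coe, if_neg hz]

theorem mob_smul_coe_of_eq {a b c d : ℂ} (h : a * d - b * c ≠ 0) {z : ℂ} (hz : c * z + d = 0) :
    mob a b c d h • (z : Sphere) = OnePoint.infty := by
  rw [mob_smul_coe, if_pos hz]

theorem mob_smul_coe_eq_coe_iff {a b c d : ℂ} (h : a * d - b * c ≠ 0) {z w : ℂ} :
    mob a b c d h • (z : Sphere) = (w : Sphere) ↔
      c * z + d ≠ 0 ∧ a * z + b = w * (c * z + d) := by
  by_cases hz : c * z + d = 0
  · simp [mob_smul_coe_of_eq h hz, hz]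
  · rw [mob_smul_coe_of_ne h hz, OnePoint.coe_eq_coe, div_eq_iff hz]
    simp [hz]

theorem moebiusGroup_ext {f g : moebiusGroup} (h : ∀ x : Sphere, f • x = g • x) : f = g :=
  Subtype.ext (Equiv.ext h)

theorem exists_eq_mob (f : moebiusGroup) :
    ∃ (a b c d : ℂ) (h : a * d - b * c ≠ 0), f = mob a b c d h := by
  obtain ⟨f, M, rfl⟩ := f
  have hM : M 0 0 * M 1 1 - M 0 1 * M 1 0 ≠ 0 := by
    simpa [Matrix.det_fin_two] using M.det_ne_zero
  refine ⟨M 0 0, M 0 1, M 1 0, M 1 1, hM, ?_⟩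
  apply moebiusGroup_ext
  intro x
  change M • x = _
  induction x using OnePoint.rec with
  | infty => rw [mob_smul_infty, OnePoint.smul_infty_eq_ite]
  | coe z => rw [mob_smul_coe, OnePoint.smul_some_eq_ite]

theorem isPrimitiveRoot_rootOfUnity {n : ℕ} (hn : n ≠ 0) : IsPrimitiveRoot (rootOfUnity n) n :=
  Complex.isPrimitiveRoot_exp n hn

/-! ### Dilations and the rotation group -/

/-- `f` is the dilation `z ↦ e z`. -/
def IsDilation (f : moebiusGroup) (e : ℂ) : Prop :=
  (∀ z : ℂ, f • (z : Sphere) = ((e * z : ℂ) : Sphere)) ∧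
    f • (OnePoint.infty : Sphere) = OnePoint.infty

theorem isDilation_moebiusRotation (n : ℕ) : IsDilation (moebiusRotation n) (rootOfUnity n) :=
  ⟨moebiusRotation_smul_coe n, moebiusRotation_smul_infty n⟩

theorem IsDilation.eq {f g : moebiusGroup} {e : ℂ} (hf : IsDilation f e) (hg : IsDilation g e) :
    f = g := by
  apply moebiusGroup_ext
  intro x
  induction x using OnePoint.rec with
  | infty => rw [hf.2, hg.2]
  | coe z => rw [hf.1, hg.1]

theorem IsDilation.pow {f : moebiusGroup} {e : ℂ} (hf : IsDilation f e) (m : ℕ) :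
    IsDilation (f ^ m) (e ^ m) := by
  induction m with
  | zero => exact ⟨by simp, by simp⟩
  | succ m ih =>
    refine ⟨fun z => ?_, ?_⟩
    · rw [pow_succ, mul_smul, hf.1, ih.1, pow_succ, mul_assoc]
    · rw [pow_succ, mul_smul, hf.2, ih.2]

theorem isDilation_one : IsDilation 1 1 := ⟨by simp, by simp⟩

theorem IsDilation.eq_one_iff {f : moebiusGroup} {e : ℂ} (hf : IsDilation f e) :
    f = 1 ↔ e = 1 := by
  constructor
  · rintro rfl
    have := hf.1 1
    rw [one_smul, OnePoint.coe_eq_coe, mul_one] at this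
    exact this.symm
  · rintro rfl
    exact hf.eq isDilation_one

theorem IsDilation.orderOf {f : moebiusGroup} {e : ℂ} (hf : IsDilation f e) :
    orderOf f = orderOf e := by
  apply orderOf_eq_orderOf_iff.2
  intro m
  exact (hf.pow m).eq_one_iff

theorem orderOf_moebiusRotation {n : ℕ} (hn : n ≠ 0) : orderOf (moebiusRotation n) = n := by
  rw [(isDilation_moebiusRotation n).orderOf, ← (isPrimitiveRoot_rootOfUnity hn).eq_orderOf]

theorem mem_rotationGroup_iff {n : ℕ} (hn : n ≠ 0) {f : moebiusGroup} :
    f ∈ rotationGroup n ↔ ∃ e : ℂ, e ^ n = 1 ∧ IsDilation f e := by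
  have hfin : IsOfFinOrder (moebiusRotation n) := by
    rw [← orderOf_pos_iff, orderOf_moebiusRotation hn]; omega
  have hζ := isPrimitiveRoot_rootOfUnity hn
  constructor
  · intro hf
    obtain ⟨j, rfl⟩ := hfin.mem_powers_iff_mem_zpowers.2 hf
    refine ⟨rootOfUnity n ^ j, ?_, (isDilation_moebiusRotation n).pow j⟩
    rw [← pow_mul, mul_comm, pow_mul, hζ.pow_eq_one, one_pow]
  · rintro ⟨e, he, hf⟩
    have : NeZero n := ⟨hn⟩
    obtain ⟨j, -, rfl⟩ := hζ.eq_pow_of_pow_eq_one he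
    rw [hf.eq ((isDilation_moebiusRotation n).pow j)]
    exact Subgroup.pow_mem _ (Subgroup.mem_zpowers _) j

theorem nonempty_rotationGroup_mulEquiv {n : ℕ} (hn : n ≠ 0) :
    Nonempty (rotationGroup n ≃* Multiplicative (ZMod n)) := by
  have hc : Nat.card (rotationGroup n) = n := by
    rw [rotationGroup, Nat.card_zpowers, orderOf_moebiusRotation hn]
  have h1 : IsCyclic (rotationGroup n) := by
    unfold rotationGroup; infer_instance
  have := zmodCyclicMulEquiv h1
  rw [hc] at this
  exact ⟨this.symm⟩

theorem mem_stabilizer_smul_mem_iff {α : Set Sphere} {f : moebiusGroup}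
    (hf : f ∈ moebiusStabilizer α) (x : Sphere) : f • x ∈ α ↔ x ∈ α := by
  have h : f • α = α := hf
  constructor
  · intro hx
    rw [← h] at hx
    exact Set.smul_mem_smul_set_iff.1 hx
  · intro hx
    rw [← h]
    exact Set.smul_mem_smul_set hx

theorem mem_moebiusStabilizer_of_forall {α : Set Sphere} (hα : α.Finite) {f : moebiusGroup}
    (hf : ∀ x ∈ α, f • x ∈ α) : f ∈ moebiusStabilizer α := by
  have hsub : f • α ⊆ α := by
    rintro _ ⟨x, hx, rfl⟩
    exact hf x hx
  refine Set.eq_of_subset_of_ncard_le hsub ?_ hα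
  rw [← Set.image_smul, Set.ncard_image_of_injective _ (MulAction.injective f)]

/-! ### Sets invariant under rotations -/

/-- The union of a set `E` of fixed points of the rotations with the orbits `z ^ n = s`, `s ∈ S`. -/
def rotSet (n : ℕ) (E : Set Sphere) (S : Set ℂ) : Set Sphere :=
  E ∪ (fun z : ℂ => (z : Sphere)) '' {z : ℂ | z ≠ 0 ∧ z ^ n ∈ S}

/-- The common fixed points of the rotations. -/
def poles : Set Sphere := {OnePoint.infty, ((0 : ℂ) : Sphere)}

theorem finite_poles : poles.Finite := by simp [poles]

theorem coe_mem_rotSet {n : ℕ} {E : Set Sphere} (hE : E ⊆ poles) {S : Set ℂ} {z : ℂ}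
    (hz : z ≠ 0) : (z : Sphere) ∈ rotSet n E S ↔ z ^ n ∈ S := by
  constructor
  · rintro (h | ⟨w, hw, h⟩)
    · rcases hE h with h | h
      · exact absurd h (OnePoint.coe_ne_infty z)
      · exact absurd (OnePoint.coe_eq_coe.1 h) hz
    · rw [← OnePoint.coe_eq_coe.1 h]; exact hw.2
  · intro h
    exact Or.inr ⟨z, ⟨hz, h⟩, rfl⟩

theorem mem_rotSet_of_mem_poles {n : ℕ} {E : Set Sphere} {S : Set ℂ} {x : Sphere}
    (hx : x ∈ poles) : x ∈ rotSet n E S ↔ x ∈ E := by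
  constructor
  · rintro (h | ⟨w, hw, rfl⟩)
    · exact h
    · rcases hx with h | h
      · exact absurd h (OnePoint.coe_ne_infty w)
      · exact absurd (OnePoint.coe_eq_coe.1 h) hw.1
  · exact Or.inl

theorem rotSet_inter_poles {n : ℕ} {E : Set Sphere} (hE : E ⊆ poles) {S : Set ℂ} :
    rotSet n E S ∩ poles = E := by
  ext x
  constructor
  · rintro ⟨h1, h2⟩; exact (mem_rotSet_of_mem_poles h2).1 h1
  · intro h; exact ⟨Or.inl h, hE h⟩

/-- Nonzero points with equal n-th powers differ by a root of unity, that is, by an element of G_n;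
so membership in α depends only on z^n. -/
theorem eq_rotSet {n : ℕ} (hn : n ≠ 0) {α : Set Sphere}
    (hα : rotationGroup n ≤ moebiusStabilizer α) :
    ∃ S : Set ℂ, 0 ∉ S ∧ α = rotSet n (α ∩ poles) S := by
  refine ⟨(fun z : ℂ => z ^ n) '' {z : ℂ | z ≠ 0 ∧ (z : Sphere) ∈ α}, ?_, ?_⟩
  · rintro ⟨z, hz, h⟩
    exact hz.1 (pow_eq_zero_iff hn |>.1 h)
  · ext x
    by_cases hx : x ∈ poles
    · rw [mem_rotSet_of_mem_poles hx]; simp [hx]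
    · induction x using OnePoint.rec with
      | infty => exact absurd (Or.inl rfl) hx
      | coe z =>
        have hz : z ≠ 0 := fun h => hx (Or.inr (by rw [h]; rfl))
        rw [coe_mem_rotSet Set.inter_subset_right hz]
        constructor
        · intro h; exact ⟨z, ⟨hz, h⟩, rfl⟩
        · rintro ⟨w, ⟨hw, hwα⟩, h⟩
          have he : (z / w) ^ n = 1 := by
            rw [div_pow, div_eq_one_iff_eq (pow_ne_zero n hw)]; exact h.symm
          have hd : z / w ≠ 0 := div_ne_zero hz hw
          have hdil : IsDilation (mob (z / w) 0 0 1 (by simpa using hd)) (z / w) := by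
            refine ⟨fun u => ?_, ?_⟩
            · rw [mob_smul_coe_of_ne _ (by simp)]; simp
            · rw [mob_smul_infty]; simp
          have hmem := hα ((mem_rotationGroup_iff hn).2 ⟨_, he, hdil⟩)
          have := (mem_stabilizer_smul_mem_iff hmem (w : Sphere)).2 hwα
          rwa [hdil.1, div_mul_cancel₀ _ hw] at this

theorem IsDilation.smul_pole {f : moebiusGroup} {e : ℂ} (hf : IsDilation f e) {x : Sphere}
    (hx : x ∈ poles) : f • x = x := by
  rcases hx with rfl | rfl
  · exact hf.2
  · rw [hf.1, mul_zero]

theorem isDilation_ne_zero {f : moebiusGroup} {e : ℂ} (hf : IsDilation f e) : e ≠ 0 := by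
  rintro rfl
  have h : f • ((1 : ℂ) : Sphere) = f • ((0 : ℂ) : Sphere) := by rw [hf.1, hf.1]; simp
  have := OnePoint.coe_eq_coe.1 (MulAction.injective f h)
  exact one_ne_zero this

theorem finite_pow_mem {n : ℕ} (hn : n ≠ 0) {S : Set ℂ} (hS : S.Finite) :
    {z : ℂ | z ^ n ∈ S}.Finite := by
  have : {z : ℂ | z ^ n ∈ S} = ⋃ s ∈ S, {z : ℂ | z ^ n = s} := by ext; simp
  rw [this]
  refine hS.biUnion fun s _ => ?_
  have h2 : {z : ℂ | z ^ n = s} = ↑(Polynomial.nthRoots n s).toFinset := by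
    ext z
    simp [Polynomial.mem_nthRoots (Nat.pos_of_ne_zero hn)]
  rw [h2]
  exact Finset.finite_toSet _

theorem finite_rotSet {n : ℕ} (hn : n ≠ 0) {E : Set Sphere} (hE : E ⊆ poles) {S : Set ℂ}
    (hS : S.Finite) : (rotSet n E S).Finite :=
  (finite_poles.subset hE).union (((finite_pow_mem hn hS).subset fun _ h => h.2).image _)

theorem rotationGroup_le_stabilizer_rotSet {n : ℕ} (hn : n ≠ 0) {E : Set Sphere}
    (hE : E ⊆ poles) {S : Set ℂ} (hS : S.Finite) :
    rotationGroup n ≤ moebiusStabilizer (rotSet n E S) := by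
  intro f hf
  obtain ⟨e, he, hd⟩ := (mem_rotationGroup_iff hn).1 hf
  refine mem_moebiusStabilizer_of_forall (finite_rotSet hn hE hS) ?_
  rintro x (h | ⟨z, ⟨hz, hzS⟩, rfl⟩)
  · rw [hd.smul_pole (hE h)]; exact Or.inl h
  · rw [hd.1, coe_mem_rotSet hE (mul_ne_zero (isDilation_ne_zero hd) hz), mul_pow, he, one_mul]
    exact hzS

/-- The fibre of `z ↦ z ^ n` over the `n`-th power of `t`. -/
theorem filter_pow_eq_image {n : ℕ} (hn : n ≠ 0) {t : ℂ} (ht : t ≠ 0) {z : ℂ} :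
    z ^ n = t ^ n ↔ z ∈ (Polynomial.nthRootsFinset n (1 : ℂ)).image (fun ζ => ζ * t) := by
  rw [Finset.mem_image]
  constructor
  · intro h
    refine ⟨z / t, ?_, div_mul_cancel₀ _ ht⟩
    rw [Polynomial.mem_nthRootsFinset (Nat.pos_of_ne_zero hn), div_pow, h,
      div_self (pow_ne_zero n ht)]
  · rintro ⟨ζ, h, rfl⟩
    rw [Polynomial.mem_nthRootsFinset (Nat.pos_of_ne_zero hn)] at h
    rw [mul_pow, h, one_mul]

theorem ncard_pow_eq {n : ℕ} (hn : n ≠ 0) {s : ℂ} (hs : s ≠ 0) : {z : ℂ | z ^ n = s}.ncard = n := by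
  obtain ⟨t, rfl⟩ := IsAlgClosed.exists_pow_nat_eq s (Nat.pos_of_ne_zero hn)
  have ht : t ≠ 0 := by rintro rfl; simp [hn] at hs
  have : {z : ℂ | z ^ n = t ^ n} =
      ↑((Polynomial.nthRootsFinset n (1 : ℂ)).image (fun ζ => ζ * t)) := by
    ext z
    rw [Set.mem_ofPred_eq, filter_pow_eq_image hn ht, Finset.mem_coe]
  rw [this, Set.ncard_coe_finset, Finset.card_image_of_injective _ (mul_left_injective₀ ht),
    (isPrimitiveRoot_rootOfUnity hn).card_nthRootsFinset]

theorem ncard_pow_mem {n : ℕ} (hn : n ≠ 0) {S : Set ℂ} (h0 : 0 ∉ S) (hS : S.Finite) :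
    {z : ℂ | z ^ n ∈ S}.ncard = n * S.ncard := by
  classical
  have hf := finite_pow_mem hn hS
  rw [Set.ncard_eq_toFinset_card _ hf, Set.ncard_eq_toFinset_card _ hS]
  rw [Finset.card_eq_sum_card_fiberwise (f := fun z : ℂ => z ^ n) (t := hS.toFinset)]
  · rw [Finset.sum_const_nat (m := n), mul_comm]
    intro s hs
    rw [Set.Finite.mem_toFinset] at hs
    refine Eq.trans ?_ (ncard_pow_eq hn (fun h => h0 (h ▸ hs) : s ≠ 0))
    rw [← Set.ncard_coe_finset]
    congr 1
    ext z
    simp only [Finset.coe_filter, Set.Finite.mem_toFinset, Set.mem_ofPred_eq]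
    exact ⟨fun h => h.2, fun h => ⟨h ▸ hs, h⟩⟩
  · intro z hz
    simpa using hz

theorem rotSet_eq {n : ℕ} (hn : n ≠ 0) {E : Set Sphere} {S : Set ℂ} (h0 : 0 ∉ S) :
    rotSet n E S = E ∪ (fun z : ℂ => (z : Sphere)) '' {z : ℂ | z ^ n ∈ S} := by
  rw [rotSet]
  congr 2
  ext z
  constructor
  · exact fun h => h.2
  · intro h
    refine ⟨?_, h⟩
    rintro rfl
    rw [Set.mem_ofPred_eq, zero_pow hn] at h
    exact h0 h

theorem ncard_rotSet {n : ℕ} (hn : n ≠ 0) {E : Set Sphere} (hE : E ⊆ poles) {S : Set ℂ}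
    (h0 : 0 ∉ S) (hS : S.Finite) : (rotSet n E S).ncard = E.ncard + n * S.ncard := by
  rw [rotSet_eq hn h0, Set.ncard_union_eq _ (finite_poles.subset hE)
    ((finite_pow_mem hn hS).image _),
    Set.ncard_image_of_injective _ OnePoint.coe_injective, ncard_pow_mem hn h0 hS]
  rw [Set.disjoint_left]
  rintro x hx ⟨z, hz, rfl⟩
  rcases hE hx with h | h
  · exact OnePoint.coe_ne_infty z h
  · replace h : z = 0 := OnePoint.coe_injective h
    rw [Set.mem_ofPred_eq, h, zero_pow hn] at hz
    exact h0 hz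

/-! ### Component index and cardinality -/

theorem cyclicOrbit_eq {n : ℕ} (hn : n ≠ 0) {z : ℂ} (hz : z ≠ 0) :
    cyclicOrbit n z = (fun w : ℂ => (w : Sphere)) '' {w : ℂ | w ^ n = z ^ n} := by
  have hζ := isPrimitiveRoot_rootOfUnity hn
  ext x
  constructor
  · rintro ⟨j, rfl⟩
    refine ⟨_, ?_, rfl⟩
    rw [Set.mem_ofPred_eq, mul_pow, ← zpow_natCast, ← zpow_mul, mul_comm j, zpow_mul, zpow_natCast,
      hζ.pow_eq_one, one_zpow, one_mul]
  · rintro ⟨w, hw, rfl⟩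
    have hwz : (w / z) ^ n = 1 := by
      rw [div_pow, div_eq_one_iff_eq (pow_ne_zero n hz)]; exact hw
    have : NeZero n := ⟨hn⟩
    obtain ⟨j, -, hj⟩ := hζ.eq_pow_of_pow_eq_one hwz
    refine ⟨j, ?_⟩
    rw [zpow_natCast, hj, div_mul_cancel₀ _ hz]

theorem cyclicIndex_fst (n : ℕ) (α : Set Sphere) : (cyclicIndex n α).1 = (α ∩ poles).ncard := by
  rw [← Set.ncard_image_of_injective (α ∩ poles) Set.singleton_injective, cyclicIndex]
  refine congrArg Set.ncard ?_
  ext o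
  constructor
  · rintro ⟨rfl | rfl, h⟩
    · exact ⟨_, ⟨h rfl, Or.inl rfl⟩, rfl⟩
    · exact ⟨_, ⟨h rfl, Or.inr rfl⟩, rfl⟩
  · rintro ⟨x, ⟨hx, hp⟩, rfl⟩
    refine ⟨?_, Set.singleton_subset_iff.2 hx⟩
    rcases hp with rfl | rfl
    · exact Or.inl rfl
    · exact Or.inr rfl

theorem cyclicIndex_rotSet {n : ℕ} (hn : n ≠ 0) {E : Set Sphere} (hE : E ⊆ poles) {S : Set ℂ}
    (h0 : 0 ∉ S) : cyclicIndex n (rotSet n E S) = (E.ncard, S.ncard) := by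
  apply Prod.ext
  · rw [cyclicIndex_fst, rotSet_inter_poles hE]
  · have hpos := Nat.pos_of_ne_zero hn
    have hinj : Set.InjOn (fun s : ℂ => (fun w : ℂ => (w : Sphere)) '' {w : ℂ | w ^ n = s}) S := by
      intro s _ s' _ h
      obtain ⟨t, ht⟩ := IsAlgClosed.exists_pow_nat_eq s hpos
      have : (t : Sphere) ∈ (fun w : ℂ => (w : Sphere)) '' {w : ℂ | w ^ n = s'} :=
        h.subset ⟨t, ht, rfl⟩
      obtain ⟨w, hw, hwt⟩ := this
      rw [← ht, ← OnePoint.coe_injective hwt]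
      exact hw
    rw [cyclicIndex]
    refine Eq.trans (congrArg Set.ncard ?_) hinj.ncard_image
    ext o
    constructor
    · rintro ⟨⟨z, hz, rfl⟩, h⟩
      rw [cyclicOrbit_eq hn hz] at h ⊢
      refine ⟨z ^ n, ?_, rfl⟩
      exact (coe_mem_rotSet hE hz).1 (h ⟨z, rfl, rfl⟩)
    · rintro ⟨s, hs, rfl⟩
      obtain ⟨t, rfl⟩ := IsAlgClosed.exists_pow_nat_eq s hpos
      have ht : t ≠ 0 := by
        rintro rfl
        rw [zero_pow hn] at hs
        exact h0 hs
      refine ⟨⟨t, ht, (cyclicOrbit_eq hn ht).symm⟩, ?_⟩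
      rintro _ ⟨w, hw, rfl⟩
      have hw' : w ^ n = t ^ n := hw
      refine (coe_mem_rotSet hE ?_).2 (hw' ▸ hs)
      rintro rfl
      rw [zero_pow hn] at hw'
      exact pow_ne_zero n ht hw'.symm

theorem finite_of_finite_rotSet {n : ℕ} (hn : n ≠ 0) {E : Set Sphere} {S : Set ℂ} (h0 : 0 ∉ S)
    (h : (rotSet n E S).Finite) : S.Finite := by
  rw [rotSet_eq hn h0] at h
  have h1 := (h.subset Set.subset_union_right).of_finite_image OnePoint.coe_injective.injOn
  refine (h1.image fun z => z ^ n).subset ?_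
  intro s hs
  obtain ⟨t, rfl⟩ := IsAlgClosed.exists_pow_nat_eq s (Nat.pos_of_ne_zero hn)
  exact ⟨t, hs, rfl⟩

theorem ncard_eq_cyclicIndex {n : ℕ} (hn : n ≠ 0) {α : Set Sphere} (hfin : α.Finite)
    (hα : rotationGroup n ≤ moebiusStabilizer α) :
    α.ncard = (cyclicIndex n α).1 + n * (cyclicIndex n α).2 := by
  obtain ⟨S, h0, h⟩ := eq_rotSet hn hα
  have hS : S.Finite := finite_of_finite_rotSet hn h0 (h ▸ hfin)
  rw [h, cyclicIndex_rotSet hn Set.inter_subset_right h0,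
    ncard_rotSet hn Set.inter_subset_right h0 hS]

/-! ### Conjugating a cyclic stabilizer to the rotation group -/

theorem exists_fixedPoint (g : moebiusGroup) : ∃ x : Sphere, g • x = x := by
  obtain ⟨a, b, c, d, h, rfl⟩ := exists_eq_mob g
  by_cases hc : c = 0
  · exact ⟨OnePoint.infty, by rw [mob_smul_infty, if_pos hc]⟩
  -- z is a square root of the discriminant of the fixed-point equation c w² + (d - a) w - b = 0.
  · obtain ⟨z, hz⟩ := IsAlgClosed.exists_pow_nat_eq ((a - d) ^ 2 + 4 * b * c) (n := 2) (by norm_num)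
    refine ⟨((a - d + z) / (2 * c) : ℂ), (mob_smul_coe_eq_coe_iff h).2 ?_⟩
    have key : a * ((a - d + z) / (2 * c)) + b =
        (a - d + z) / (2 * c) * (c * ((a - d + z) / (2 * c)) + d) := by
      field_simp
      linear_combination -hz
    -- If c w + d vanished at this root, so would a w + b, and the determinant would be zero.
    refine ⟨fun h0 => ?_, key⟩
    rw [h0, mul_zero] at key
    apply h
    generalize (a - d + z) / (2 * c) = w at key h0
    linear_combination a * h0 - c * key

theorem exists_smul_eq_infty (x : Sphere) : ∃ f : moebiusGroup, f • x = OnePoint.infty := by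
  induction x using OnePoint.rec with
  | infty => exact ⟨1, one_smul _ _⟩
  | coe z => exact ⟨mob 0 1 1 (-z) (by simp), mob_smul_coe_of_eq _ (by ring)⟩

theorem exists_affine_of_fixes_infty {f : moebiusGroup}
    (hf : f • (OnePoint.infty : Sphere) = OnePoint.infty) :
    ∃ A B : ℂ, A ≠ 0 ∧ ∀ z : ℂ, f • (z : Sphere) = ((A * z + B : ℂ) : Sphere) := by
  obtain ⟨a, b, c, d, h, rfl⟩ := exists_eq_mob f
  have hc : c = 0 := by
    by_contra hc
    rw [mob_smul_infty, if_neg hc] at hf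
    exact OnePoint.coe_ne_infty _ hf
  subst hc
  have had : a * d ≠ 0 := by simpa using h
  have ha := left_ne_zero_of_mul had
  have hd := right_ne_zero_of_mul had
  refine ⟨a / d, b / d, div_ne_zero ha hd, fun z => ?_⟩
  rw [mob_smul_coe_of_ne _ (by simpa using hd)]
  rw [zero_mul, zero_add, add_div, mul_div_right_comm]

/-- With a fixed point at ∞ the map is z ↦ A z + B. A nontrivial translation has infinite order, so
A ≠ 1, and the second fixed point q = B / (1 - A) can be translated to 0. -/
theorem exists_conj_isDilation {g : moebiusGroup} (h1 : g ≠ 1) (hg : IsOfFinOrder g) :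
    ∃ (φ : moebiusGroup) (e : ℂ), IsDilation (φ * g * φ⁻¹) e := by
  obtain ⟨p, hp⟩ := exists_fixedPoint g
  obtain ⟨φ, hφ⟩ := exists_smul_eq_infty p
  have hinf : (φ * g * φ⁻¹) • (OnePoint.infty : Sphere) = OnePoint.infty := by
    rw [mul_smul, mul_smul, inv_smul_eq_iff.2 hφ.symm, hp, hφ]
  obtain ⟨A, B, -, hAB⟩ := exists_affine_of_fixes_infty hinf
  have hA : A ≠ 1 := by
    rintro rfl
    have hpow : ∀ (m : ℕ) (z : ℂ),
        (φ * g * φ⁻¹) ^ m • (z : Sphere) = ((z + m * B : ℂ) : Sphere) := by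
      intro m
      induction m with
      | zero => intro z; simp
      | succ m ih =>
        intro z
        rw [pow_succ, mul_smul, hAB, ih]
        congr 1
        push_cast
        ring
    obtain ⟨m, hm, hgm⟩ := isOfFinOrder_iff_pow_eq_one.1 hg
    have h2 := hpow m 0
    rw [conj_pow, hgm, mul_one, mul_inv_cancel, one_smul, OnePoint.coe_eq_coe, zero_add] at h2
    have hB : B = 0 := by
      rcases mul_eq_zero.1 h2.symm with h | h
      · exact absurd (Nat.cast_eq_zero.1 h) hm.ne'
      · exact h
    apply h1
    rw [← conj_eq_one_iff (a := φ), isDilation_one.eq ⟨fun z => ?_, hinf⟩]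
    rw [hAB, hB, add_zero]
  have hA' : 1 - A ≠ 0 := sub_ne_zero.2 hA.symm
  set q : ℂ := B / (1 - A) with hq
  have hτ : ∀ z : ℂ, (mob 1 (-q) 0 1 (by simp)) • (z : Sphere) = ((z - q : ℂ) : Sphere) := by
    intro z
    rw [mob_smul_coe_of_ne _ (by simp)]
    congr 1
    ring
  have hτi : (mob 1 (-q) 0 1 (by simp)) • (OnePoint.infty : Sphere) = OnePoint.infty := by
    rw [mob_smul_infty, if_pos rfl]
  generalize mob 1 (-q) 0 1 (by simp) = τ at hτ hτi
  refine ⟨τ * φ, A, fun z => ?_, ?_⟩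
  · have h3 : τ⁻¹ • (z : Sphere) = ((z + q : ℂ) : Sphere) := by
      rw [inv_smul_eq_iff, hτ, add_sub_cancel_right]
    have h4 : τ * φ * g * (τ * φ)⁻¹ = τ * (φ * g * φ⁻¹) * τ⁻¹ := by group
    rw [h4, mul_smul, h3, mul_smul, hAB, hτ]
    congr 1
    rw [hq]
    field_simp
    ring
  · have h4 : τ * φ * g * (τ * φ)⁻¹ = τ * (φ * g * φ⁻¹) * τ⁻¹ := by group
    rw [h4, mul_smul, inv_smul_eq_iff.2 hτi.symm, mul_smul, hinf, hτi]

theorem moebiusStabilizer_smul (φ : moebiusGroup) (α : Set Sphere) :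
    moebiusStabilizer (φ • α) = (moebiusStabilizer α).map (MulAut.conj φ).toMonoidHom :=
  MulAction.stabilizer_smul_eq_stabilizer_map_conj φ α

/-- A generator becomes a dilation whose factor is an n-th root of unity, so the conjugated
stabilizer lies in G_n; both groups have n elements. -/
theorem exists_smul_stabilizer_eq_rotationGroup {n : ℕ} (hn : 2 ≤ n) {α : Set Sphere}
    (e : moebiusStabilizer α ≃* Multiplicative (ZMod n)) :
    ∃ φ : moebiusGroup, moebiusStabilizer (φ • α) = rotationGroup n := by
  have hn0 : n ≠ 0 := by omega
  have : NeZero n := ⟨hn0⟩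
  have hcyc : IsCyclic (moebiusStabilizer α) := isCyclic_of_surjective e.symm e.symm.surjective
  obtain ⟨g, hg⟩ := (Subgroup.isCyclic_iff_exists_zpowers_eq_top _).1 hcyc
  have hcard : Nat.card (moebiusStabilizer α) = n := by
    rw [Nat.card_congr e.toEquiv, Nat.card_eq_fintype_card, Fintype.card_multiplicative,
      ZMod.card]
  have hord : orderOf g = n := by rw [← hcard, ← hg, Nat.card_zpowers]
  have hfin : IsOfFinOrder g := by rw [← orderOf_pos_iff]; omega
  have hg1 : g ≠ 1 := by
    intro h
    rw [h, orderOf_one] at hord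
    omega
  obtain ⟨φ, ε, hε⟩ := exists_conj_isDilation hg1 hfin
  refine ⟨φ, ?_⟩
  have hmap : moebiusStabilizer (φ • α) = Subgroup.zpowers (φ * g * φ⁻¹) := by
    rw [moebiusStabilizer_smul, ← hg, MonoidHom.map_zpowers]
    rfl
  have hord' : orderOf (φ * g * φ⁻¹) = n := by
    rw [← hord]
    exact MulEquiv.orderOf_eq (MulAut.conj φ) g
  rw [hmap]
  have hfinG : Finite (rotationGroup n) := by
    apply Nat.finite_of_card_ne_zero
    rw [rotationGroup, Nat.card_zpowers, orderOf_moebiusRotation hn0]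
    exact hn0
  refine Subgroup.eq_of_le_of_card_ge ?_ ?_
  · rw [Subgroup.zpowers_le, mem_rotationGroup_iff hn0]
    refine ⟨ε, ?_, hε⟩
    rw [← (hε.pow n).eq_one_iff, ← hord', pow_orderOf_eq_one]
  · rw [rotationGroup, Nat.card_zpowers, orderOf_moebiusRotation hn0, Nat.card_zpowers, hord']

/-! ### Independence of the normalization -/

theorem mem_poles_iff_moebiusRotation_smul {n : ℕ} (hn : 2 ≤ n) {x : Sphere} :
    x ∈ poles ↔ moebiusRotation n • x = x := by
  constructor
  · exact (isDilation_moebiusRotation n).smul_pole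
  · intro h
    induction x using OnePoint.rec with
    | infty => exact Or.inl rfl
    | coe z =>
      right
      rw [moebiusRotation_smul_coe, OnePoint.coe_eq_coe] at h
      have h1 : rootOfUnity n ≠ 1 := (isPrimitiveRoot_rootOfUnity (by omega)).ne_one (by omega)
      have h2 : (rootOfUnity n - 1) * z = 0 := by linear_combination h
      rcases mul_eq_zero.1 h2 with h3 | h3
      · exact absurd (sub_eq_zero.1 h3) h1
      · rw [h3]; rfl

theorem cyclicIndex_smul_eq {n : ℕ} (hn : 2 ≤ n) {α : Set Sphere} (hfin : α.Finite)
    (hα : moebiusStabilizer α = rotationGroup n) {χ : moebiusGroup}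
    (hχ : moebiusStabilizer (χ • α) = rotationGroup n) :
    cyclicIndex n (χ • α) = cyclicIndex n α := by
  have hn0 : n ≠ 0 := by omega
  -- χ conjugates G_n onto itself, and the poles are the fixed points of its generator, so χ
  -- permutes them.
  have hpoles : χ • poles = poles := by
    refine Set.eq_of_subset_of_ncard_le ?_ ?_ finite_poles
    · rintro _ ⟨x, hx, rfl⟩
      have hmem : moebiusRotation n ∈ (rotationGroup n).map (MulAut.conj χ).toMonoidHom := by
        rw [← hα, ← moebiusStabilizer_smul, hχ]
        exact Subgroup.mem_zpowers _
      obtain ⟨r, hr, hrχ⟩ := hmem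
      obtain ⟨e, -, he⟩ := (mem_rotationGroup_iff hn0).1 hr
      have hrχ' : χ * r * χ⁻¹ = moebiusRotation n := hrχ
      change χ • x ∈ poles
      rw [mem_poles_iff_moebiusRotation_smul hn, ← hrχ', mul_smul, inv_smul_smul, mul_smul,
        he.smul_pole hx]
    · rw [← Set.image_smul, Set.ncard_image_of_injective _ (MulAction.injective χ)]
  have hfst : (cyclicIndex n (χ • α)).1 = (cyclicIndex n α).1 := by
    rw [cyclicIndex_fst, cyclicIndex_fst,
      ← Set.ncard_image_of_injective (α ∩ poles) (MulAction.injective χ),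
      Set.image_smul, Set.smul_set_inter, hpoles]
  apply Prod.ext hfst
  have h1 := ncard_eq_cyclicIndex hn0 hfin hα.ge
  have h2 := ncard_eq_cyclicIndex hn0 (hfin.smul_set (a := χ)) hχ.ge
  rw [← Set.image_smul, Set.ncard_image_of_injective _ (MulAction.injective χ), Set.image_smul,
    hfst, h1] at h2
  exact (Nat.eq_of_mul_eq_mul_left (by omega) (Nat.add_left_cancel h2)).symm

theorem cyclicIndex_fst_le (n : ℕ) (α : Set Sphere) : (cyclicIndex n α).1 ≤ 2 := by
  rw [cyclicIndex_fst]
  refine (Set.ncard_le_ncard Set.inter_subset_right finite_poles).trans ?_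
  exact (Set.ncard_insert_le _ _).trans (by rw [Set.ncard_singleton])

theorem exists_unique_cyclicIndex {n : ℕ} (hn : 2 ≤ n) {α : Set Sphere} (hfin : α.Finite)
    (e : Nonempty (moebiusStabilizer α ≃* Multiplicative (ZMod n))) :
    ∃ p : ℕ × ℕ, (∀ q : ℕ × ℕ, HasCyclicIndex n α q ↔ q = p) ∧
      p.1 ≤ 2 ∧ α.ncard = p.1 + n * p.2 := by
  obtain ⟨e⟩ := e
  obtain ⟨φ, hφ⟩ := exists_smul_stabilizer_eq_rotationGroup hn e
  refine ⟨cyclicIndex n (φ • α), fun q => ⟨?_, ?_⟩, cyclicIndex_fst_le _ _, ?_⟩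
  · rintro ⟨ψ, hψ, rfl⟩
    have h : ψ • α = (ψ * φ⁻¹) • φ • α := by rw [smul_smul, inv_mul_cancel_right]
    rw [h] at hψ ⊢
    exact cyclicIndex_smul_eq hn hfin.smul_set hφ hψ
  · rintro rfl
    exact ⟨φ, hφ, rfl⟩
  · rw [← ncard_eq_cyclicIndex (by omega) hfin.smul_set hφ.ge, ← Set.image_smul,
      Set.ncard_image_of_injective _ (MulAction.injective φ)]

/-! ### Extra symmetries for the excluded indices -/

theorem inversion_smul_coe {e : ℂ} (he : 0 * 0 - e * 1 ≠ 0) {z : ℂ} (hz : z ≠ 0) :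
    mob 0 e 1 0 he • (z : Sphere) = ((e / z : ℂ) : Sphere) := by
  rw [mob_smul_coe_of_ne _ (by simpa using hz)]
  congr 1
  ring

theorem inversion_smul_zero {e : ℂ} (he : 0 * 0 - e * 1 ≠ 0) :
    mob 0 e 1 0 he • ((0 : ℂ) : Sphere) = OnePoint.infty :=
  mob_smul_coe_of_eq _ (by ring)

theorem inversion_smul_infty {e : ℂ} (he : 0 * 0 - e * 1 ≠ 0) :
    mob 0 e 1 0 he • (OnePoint.infty : Sphere) = ((0 : ℂ) : Sphere) := by
  rw [mob_smul_infty, if_neg one_ne_zero, zero_div]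

/-- With e^n = u, the map z ↦ e/z acts on n-th powers by s ↦ u/s and swaps the poles. It moves ∞, so
it is not a rotation. -/
theorem not_stabilizer_le_of_inversion {n : ℕ} (hn : n ≠ 0) {E : Set Sphere}
    (hE : E = ∅ ∨ E = poles) {S : Set ℂ} (hS : S.Finite) {u : ℂ} (hu : u ≠ 0)
    (h : ∀ s ∈ S, u / s ∈ S) :
    ¬ moebiusStabilizer (rotSet n E S) ≤ rotationGroup n := by
  intro hle
  have hE' : E ⊆ poles := by rcases hE with rfl | rfl <;> simp
  obtain ⟨e, rfl⟩ := IsAlgClosed.exists_pow_nat_eq u (Nat.pos_of_ne_zero hn)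
  have he : e ≠ 0 := by rintro rfl; exact hu (zero_pow hn)
  have hdet : (0 : ℂ) * 0 - e * 1 ≠ 0 := by simpa using he
  have hmem : mob 0 e 1 0 hdet ∈ moebiusStabilizer (rotSet n E S) := by
    refine mem_moebiusStabilizer_of_forall (finite_rotSet hn hE' hS) ?_
    rintro x (hx | ⟨z, ⟨hz, hzS⟩, rfl⟩)
    · rcases hE with rfl | rfl
      · exact absurd hx (Set.notMem_empty x)
      · left
        rcases hx with rfl | rfl
        · rw [inversion_smul_infty]; exact Or.inr rfl
        · rw [inversion_smul_zero]; exact Or.inl rfl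
    · rw [inversion_smul_coe _ hz, coe_mem_rotSet hE' (div_ne_zero he hz), div_pow]
      exact h _ hzS
  obtain ⟨ε, -, hε⟩ := (mem_rotationGroup_iff hn).1 (hle hmem)
  have := hε.2
  rw [inversion_smul_infty] at this
  exact OnePoint.coe_ne_infty _ this

/-- Every dilation preserves a set of poles, and 2 is not a root of unity. -/
theorem not_stabilizer_le_of_empty {n : ℕ} (hn : n ≠ 0) {E : Set Sphere} (hE : E ⊆ poles) :
    ¬ moebiusStabilizer (rotSet n E ∅) ≤ rotationGroup n := by
  intro hle
  have hdil : IsDilation (mob 2 0 0 1 (by simp)) 2 := by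
    refine ⟨fun z => ?_, ?_⟩
    · rw [mob_smul_coe_of_ne _ (by simp)]; simp
    · rw [mob_smul_infty, if_pos rfl]
  have hmem : mob 2 0 0 1 (by simp) ∈ moebiusStabilizer (rotSet n E ∅) := by
    refine mem_moebiusStabilizer_of_forall (finite_rotSet hn hE Set.finite_empty) ?_
    rintro x (hx | ⟨z, ⟨hz, hzS⟩, rfl⟩)
    · rw [hdil.smul_pole (hE hx)]; exact Or.inl hx
    · exact absurd hzS (Set.notMem_empty _)
  obtain ⟨ε, hε1, hε⟩ := (mem_rotationGroup_iff hn).1 (hle hmem)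
  have h2 : (2 : ℂ) = ε := by
    have := (hdil.1 1).symm.trans (hε.1 1)
    rw [OnePoint.coe_eq_coe] at this
    simpa using this
  rw [← h2] at hε1
  have h3 : (2 : ℕ) ^ n = 1 := by exact_mod_cast hε1
  exact absurd ((Nat.pow_eq_one.1 h3).resolve_right hn) (by norm_num)

/-- The involution z ↦ t (z + m t) / (z - t) exchanges ∞ and t. For n = 2 it fixes the third point
-t; for n = 3 the four points are the vertices of a tetrahedron, and it also exchanges the other
two. -/
theorem not_stabilizer_le_of_infty {n : ℕ} (hn : n = 2 ∨ n = 3) {t : ℂ} (ht : t ≠ 0) :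
    ¬ moebiusStabilizer (rotSet n {OnePoint.infty} {t ^ n}) ≤ rotationGroup n := by
  intro hle
  have hn0 : n ≠ 0 := by omega
  have hE : ({OnePoint.infty} : Set Sphere) ⊆ poles := by rintro x rfl; exact Or.inl rfl
  -- m makes (z + m t) / (z - t) an n-th root of unity at every other root z; m ≠ -1 keeps the
  -- determinant nonzero.
  obtain ⟨m, hm1, hm⟩ : ∃ m : ℂ, m ≠ -1 ∧
      ∀ z : ℂ, z ≠ t → z ^ n = t ^ n → (z + m * t) ^ n = (z - t) ^ n := by
    rcases hn with rfl | rfl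
    · refine ⟨3, by norm_num, fun z hz h => ?_⟩
      have h0 : z + t = 0 := mul_left_cancel₀ (sub_ne_zero.2 hz) (by linear_combination h)
      linear_combination 8 * t * h0
    · refine ⟨2, by norm_num, fun z hz h => ?_⟩
      have h0 : z ^ 2 + z * t + t ^ 2 = 0 :=
        mul_left_cancel₀ (sub_ne_zero.2 hz) (by linear_combination h)
      linear_combination 9 * t * h0
  have hdet : t * (-t) - (m * t ^ 2) * 1 ≠ 0 := by
    have : t * (-t) - (m * t ^ 2) * 1 = -(m + 1) * t ^ 2 := by ring
    rw [this]
    refine mul_ne_zero (neg_ne_zero.2 fun h => hm1 (eq_neg_of_add_eq_zero_left h)) (pow_ne_zero 2 ht)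
  have hinf : mob t (m * t ^ 2) 1 (-t) hdet • (OnePoint.infty : Sphere) = (t : Sphere) := by
    rw [mob_smul_infty, if_neg one_ne_zero, div_one]
  have hmem : mob t (m * t ^ 2) 1 (-t) hdet ∈
      moebiusStabilizer (rotSet n {OnePoint.infty} {t ^ n}) := by
    refine mem_moebiusStabilizer_of_forall (finite_rotSet hn0 hE (Set.finite_singleton _)) ?_
    rintro x (rfl | ⟨z, ⟨hz, hzS⟩, rfl⟩)
    · rw [hinf, coe_mem_rotSet hE ht]; rfl
    · by_cases hzt : z = t
      · subst hzt
        rw [mob_smul_coe_of_eq _ (by ring)]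
        exact Or.inl rfl
      · have hd : z - t ≠ 0 := sub_ne_zero.2 hzt
        have hpow : ((t * z + m * t ^ 2) / (1 * z + -t)) ^ n = t ^ n := by
          have e1 : (t * z + m * t ^ 2) / (1 * z + -t) = t * ((z + m * t) / (z - t)) := by
            rw [one_mul, ← sub_eq_add_neg]; ring
          rw [e1, mul_pow, div_pow, hm z hzt hzS, div_self (pow_ne_zero n hd), mul_one]
        rw [mob_smul_coe_of_ne _ (by rwa [one_mul, ← sub_eq_add_neg]), coe_mem_rotSet hE]
        · exact hpow
        · intro h0
          rw [h0, zero_pow hn0] at hpow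
          exact pow_ne_zero n ht hpow.symm
  obtain ⟨ε, -, hε⟩ := (mem_rotationGroup_iff hn0).1 (hle hmem)
  have := hε.2
  rw [hinf] at this
  exact OnePoint.coe_ne_infty _ this

/-- The involution used for ∞, conjugated by z ↦ t²/z: it is z ↦ t (t - z) / (t + m z) and exchanges
0 and t. -/
theorem not_stabilizer_le_of_zero {n : ℕ} (hn : n = 2 ∨ n = 3) {t : ℂ} (ht : t ≠ 0) :
    ¬ moebiusStabilizer (rotSet n {((0 : ℂ) : Sphere)} {t ^ n}) ≤ rotationGroup n := by
  intro hle
  have hn0 : n ≠ 0 := by omega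
  have hE : ({((0 : ℂ) : Sphere)} : Set Sphere) ⊆ poles := by rintro x rfl; exact Or.inr rfl
  obtain ⟨m, hm1, hm⟩ : ∃ m : ℂ, m ≠ -1 ∧
      ∀ z : ℂ, z ≠ t → z ^ n = t ^ n → (t - z) ^ n = (t + m * z) ^ n := by
    rcases hn with rfl | rfl
    · refine ⟨3, by norm_num, fun z hz h => ?_⟩
      have h0 : z + t = 0 := mul_left_cancel₀ (sub_ne_zero.2 hz) (by linear_combination h)
      linear_combination -8 * z * h0
    · refine ⟨2, by norm_num, fun z hz h => ?_⟩
      have h0 : z ^ 2 + z * t + t ^ 2 = 0 :=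
        mul_left_cancel₀ (sub_ne_zero.2 hz) (by linear_combination h)
      linear_combination -9 * z * h0
  have hdet : (-t) * t - t ^ 2 * m ≠ 0 := by
    have : (-t) * t - t ^ 2 * m = -(m + 1) * t ^ 2 := by ring
    rw [this]
    refine mul_ne_zero (neg_ne_zero.2 fun h => hm1 (eq_neg_of_add_eq_zero_left h)) (pow_ne_zero 2 ht)
  have hzero : mob (-t) (t ^ 2) m t hdet • ((0 : ℂ) : Sphere) = (t : Sphere) := by
    rw [mob_smul_coe_eq_coe_iff]
    exact ⟨by simpa using ht, by ring⟩
  have hmem : mob (-t) (t ^ 2) m t hdet ∈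
      moebiusStabilizer (rotSet n {((0 : ℂ) : Sphere)} {t ^ n}) := by
    refine mem_moebiusStabilizer_of_forall (finite_rotSet hn0 hE (Set.finite_singleton _)) ?_
    rintro x (rfl | ⟨z, ⟨hz, hzS⟩, rfl⟩)
    · rw [hzero, coe_mem_rotSet hE ht]; rfl
    · by_cases hzt : z = t
      · subst hzt
        have : mob (-z) (z ^ 2) m z hdet • (z : Sphere) = ((0 : ℂ) : Sphere) := by
          rw [mob_smul_coe_eq_coe_iff]
          refine ⟨fun h => ?_, by ring⟩
          have : (m + 1) * z = 0 := by linear_combination h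
          exact hm1 (eq_neg_of_add_eq_zero_left ((mul_eq_zero.1 this).resolve_right ht))
        rw [this]
        exact Or.inl rfl
      · have hpow' := hm z hzt hzS
        have hd : t + m * z ≠ 0 := by
          intro h
          rw [h, zero_pow hn0] at hpow'
          exact hzt (sub_eq_zero.1 (pow_eq_zero_iff hn0 |>.1 hpow')).symm
        have hpow : ((-t * z + t ^ 2) / (m * z + t)) ^ n = t ^ n := by
          have e1 : (-t * z + t ^ 2) / (m * z + t) = t * ((t - z) / (t + m * z)) := by
            rw [add_comm (m * z)]; ring
          rw [e1, mul_pow, div_pow, hpow', div_self (pow_ne_zero n hd), mul_one]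
        rw [mob_smul_coe_of_ne _ (by rwa [add_comm]), coe_mem_rotSet hE]
        · exact hpow
        · intro h0
          rw [h0, zero_pow hn0] at hpow
          exact pow_ne_zero n ht hpow.symm
  obtain ⟨ε, -, hε⟩ := (mem_rotationGroup_iff hn0).1 (hle hmem)
  have := hε.1 0
  rw [hzero, OnePoint.coe_eq_coe, mul_zero] at this
  exact ht this

theorem eq_singleton_of_subset_poles {E : Set Sphere} (hE : E ⊆ poles) (h : E.ncard = 1) :
    E = {OnePoint.infty} ∨ E = {((0 : ℂ) : Sphere)} := by
  obtain ⟨x, rfl⟩ := Set.ncard_eq_one.1 h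
  rcases hE rfl with rfl | hx
  · exact Or.inl rfl
  · rw [hx]; exact Or.inr rfl

theorem ncard_poles : poles.ncard = 2 :=
  Set.ncard_pair (OnePoint.coe_ne_infty 0).symm

theorem eq_empty_or_eq_poles {E : Set Sphere} (hE : E ⊆ poles) (h : E.ncard = 0 ∨ E.ncard = 2) :
    E = ∅ ∨ E = poles := by
  rcases h with h | h
  · exact Or.inl ((Set.ncard_eq_zero (finite_poles.subset hE)).1 h)
  · exact Or.inr (Set.eq_of_subset_of_ncard_le hE (by rw [ncard_poles, h]) finite_poles)

theorem index_of_stabilizer_eq_rotationGroup {n : ℕ} (hn : 2 ≤ n) {α : Set Sphere}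
    (hfin : α.Finite) (hα : moebiusStabilizer α = rotationGroup n) {ν k : ℕ} (hν : ν ≤ 2)
    (hi : cyclicIndex n α = (ν, k)) :
    3 ≤ k ∨ (ν = 1 ∧ k = 2) ∨ (4 ≤ n ∧ ν = 1 ∧ k = 1) := by
  have hn0 : n ≠ 0 := by omega
  obtain ⟨S, h0, h⟩ := eq_rotSet hn0 hα.ge
  have hE : α ∩ poles ⊆ poles := Set.inter_subset_right
  generalize α ∩ poles = E at h hE
  subst h
  have hS := finite_of_finite_rotSet hn0 h0 hfin
  rw [cyclicIndex_rotSet hn0 hE h0, Prod.mk.injEq] at hi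
  obtain ⟨hEν, hSk⟩ := hi
  by_contra hcon
  have hk : k ≠ 0 := by
    rintro rfl
    rw [(Set.ncard_eq_zero hS).1 hSk] at hα
    exact not_stabilizer_le_of_empty hn0 hE hα.le
  have hν1 : ν = 1 := by
    by_contra hν1
    have hE2 := eq_empty_or_eq_poles hE (by omega)
    have hk2 : k = 1 ∨ k = 2 := by omega
    rcases hk2 with rfl | rfl
    · obtain ⟨s, rfl⟩ := Set.ncard_eq_one.1 hSk
      have hs : s ≠ 0 := fun h => h0 h.symm
      -- u = s² makes s ↦ u/s fix the single element of S; for two elements, u = s t exchanges them.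
      refine not_stabilizer_le_of_inversion hn0 hE2 hS (mul_ne_zero hs hs) ?_ hα.le
      rintro x rfl
      exact mul_div_cancel_right₀ _ hs
    · obtain ⟨s, t, -, rfl⟩ := Set.ncard_eq_two.1 hSk
      have hs : s ≠ 0 := fun h => h0 (Or.inl h.symm)
      have ht : t ≠ 0 := fun h => h0 (Or.inr h.symm)
      refine not_stabilizer_le_of_inversion hn0 hE2 hS (mul_ne_zero hs ht) ?_ hα.le
      rintro x (rfl | rfl)
      · exact Or.inr (mul_div_cancel_left₀ _ hs)
      · exact Or.inl (mul_div_cancel_right₀ _ ht)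
  have hk1 : k = 1 := by omega
  subst hk1 hν1
  obtain ⟨s, rfl⟩ := Set.ncard_eq_one.1 hSk
  obtain ⟨t, rfl⟩ := IsAlgClosed.exists_pow_nat_eq s (Nat.pos_of_ne_zero hn0)
  have ht : t ≠ 0 := by
    rintro rfl
    exact h0 (zero_pow hn0).symm
  have hn23 : n = 2 ∨ n = 3 := by omega
  rcases eq_singleton_of_subset_poles hE hEν with rfl | rfl
  · exact not_stabilizer_le_of_infty hn23 ht hα.le
  · exact not_stabilizer_le_of_zero hn23 ht hα.le

/-! ### Symmetries of sets on the unit circle -/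

open scoped ComplexConjugate

/-- The condition that `z ↦ (a z + b) / (c z + d)` maps the unit circle to itself. -/
def PreservesCircle (a b c d : ℂ) : Prop :=
  Complex.normSq a + Complex.normSq b = Complex.normSq c + Complex.normSq d ∧
    a * conj b = c * conj d

theorem conj_eq_inv_of_norm_eq_one {z : ℂ} (hz : ‖z‖ = 1) : z * conj z = 1 := by
  rw [Complex.mul_conj, Complex.normSq_eq_norm_sq, hz]; simp

/-- Since conj z = 1/z on the circle, multiplying |a z + b|² by z gives a quadratic polynomial in z,
so circle preservation becomes a comparison of coefficients. -/
theorem normSq_mul_add {a b z : ℂ} (hz : ‖z‖ = 1) :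
    (Complex.normSq (a * z + b) : ℂ) * z =
      a * conj b * z ^ 2 + (Complex.normSq a + Complex.normSq b : ℝ) * z + conj (a * conj b) := by
  have h := conj_eq_inv_of_norm_eq_one hz
  push_cast
  simp only [← Complex.mul_conj, map_add, map_mul, Complex.conj_conj]
  linear_combination (a * conj a * z + b * conj a) * h

/-- The difference of the two quadratics has three distinct roots, hence vanishes identically. -/
theorem preservesCircle_of_three {a b c d z₁ z₂ z₃ : ℂ} (h12 : z₁ ≠ z₂) (h13 : z₁ ≠ z₃)
    (h23 : z₂ ≠ z₃) (n1 : ‖z₁‖ = 1) (n2 : ‖z₂‖ = 1) (n3 : ‖z₃‖ = 1)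
    (e1 : ‖a * z₁ + b‖ = ‖c * z₁ + d‖) (e2 : ‖a * z₂ + b‖ = ‖c * z₂ + d‖)
    (e3 : ‖a * z₃ + b‖ = ‖c * z₃ + d‖) : PreservesCircle a b c d := by
  set w : ℂ := a * conj b - c * conj d with hw
  set r : ℂ := ((Complex.normSq a + Complex.normSq b : ℝ) : ℂ) -
    ((Complex.normSq c + Complex.normSq d : ℝ) : ℂ) with hr
  have key : ∀ z : ℂ, ‖z‖ = 1 → ‖a * z + b‖ = ‖c * z + d‖ →
      w * z ^ 2 + r * z + conj w = 0 := by
    intro z hz he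
    have h1 := normSq_mul_add (a := a) (b := b) hz
    have h2 := normSq_mul_add (a := c) (b := d) hz
    rw [Complex.normSq_eq_norm_sq, he, ← Complex.normSq_eq_norm_sq, h2] at h1
    rw [hw, hr, map_sub]
    linear_combination -h1
  have k1 := key z₁ n1 e1
  have k2 := key z₂ n2 e2
  have k3 := key z₃ n3 e3
  have l12 : w * (z₁ + z₂) + r = 0 :=
    mul_left_cancel₀ (sub_ne_zero.2 h12) (by linear_combination k1 - k2)
  have l13 : w * (z₁ + z₃) + r = 0 :=
    mul_left_cancel₀ (sub_ne_zero.2 h13) (by linear_combination k1 - k3)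
  have hw0 : w = 0 := mul_right_cancel₀ (sub_ne_zero.2 h23) (by linear_combination l12 - l13)
  have hr0 : r = 0 := by rw [hw0] at l12; linear_combination l12
  refine ⟨?_, sub_eq_zero.1 (hw ▸ hw0)⟩
  exact_mod_cast sub_eq_zero.1 (hr ▸ hr0)

theorem PreservesCircle.norm_eq {a b c d : ℂ} (h : PreservesCircle a b c d) {z : ℂ}
    (hz : ‖z‖ = 1) : ‖a * z + b‖ = ‖c * z + d‖ := by
  have h1 := normSq_mul_add (a := a) (b := b) hz
  have h2 := normSq_mul_add (a := c) (b := d) hz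
  rw [h.1, h.2, ← h2] at h1
  have hz0 : z ≠ 0 := by rintro rfl; simp at hz
  have h3 : Complex.normSq (a * z + b) = Complex.normSq (c * z + d) := by
    exact_mod_cast mul_right_cancel₀ hz0 h1
  rw [Complex.normSq_eq_norm_sq, Complex.normSq_eq_norm_sq] at h3
  exact (sq_eq_sq₀ (norm_nonneg _) (norm_nonneg _)).1 h3

theorem PreservesCircle.denom_ne_zero {a b c d : ℂ} (h : PreservesCircle a b c d)
    (hdet : a * d - b * c ≠ 0) {z : ℂ} (hz : ‖z‖ = 1) : c * z + d ≠ 0 := by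
  intro h0
  have h1 : a * z + b = 0 := by rw [← norm_eq_zero, h.norm_eq hz, h0, norm_zero]
  exact hdet (by linear_combination a * h0 - c * h1)

theorem norm_eq_one_of_pow_mem {n : ℕ} (hn : n ≠ 0) {S : Set ℂ} (hS : ∀ s ∈ S, ‖s‖ = 1) {z : ℂ}
    (hz : z ^ n ∈ S) : ‖z‖ = 1 := by
  have := hS _ hz
  rw [norm_pow] at this
  exact (pow_eq_one_iff_of_nonneg (norm_nonneg z) hn).1 this

theorem mem_rotSet_cases {n : ℕ} {E : Set Sphere} {S : Set ℂ} {x : Sphere}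
    (hx : x ∈ rotSet n E S) (hxE : x ∉ E) : ∃ w : ℂ, w ^ n ∈ S ∧ x = (w : Sphere) := by
  rcases hx with h | ⟨w, ⟨-, hw⟩, rfl⟩
  · exact absurd h hxE
  · exact ⟨w, hw, rfl⟩

/-- By injectivity at most |E| of the n|S| circle points are sent into E; at least three of the
others remain on the circle. -/
theorem preservesCircle_of_mem_stabilizer {n : ℕ} (hn : n ≠ 0) {E : Set Sphere} (hE : E ⊆ poles)
    {S : Set ℂ} (hS : ∀ s ∈ S, ‖s‖ = 1) (hfin : S.Finite) (hcard : E.ncard + 3 ≤ n * S.ncard)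
    {a b c d : ℂ} {hdet : a * d - b * c ≠ 0}
    (hf : mob a b c d hdet ∈ moebiusStabilizer (rotSet n E S)) : PreservesCircle a b c d := by
  have h0 : (0 : ℂ) ∉ S := fun h => by simpa using hS 0 h
  have hEfin := finite_poles.subset hE
  set T : Set ℂ := {z : ℂ | z ^ n ∈ S} with hT
  have hTfin : T.Finite := finite_pow_mem hn hfin
  have hTcard : T.ncard = n * S.ncard := ncard_pow_mem hn h0 hfin
  set f := mob a b c d hdet with hfdef
  set U : Set ℂ := {z ∈ T | f • (z : Sphere) ∈ E} with hU
  have hUcard : U.ncard ≤ E.ncard := by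
    refine Set.ncard_le_ncard_of_injOn (fun z : ℂ => f • (z : Sphere)) (fun z hz => hz.2) ?_ hEfin
    intro z _ w _ h
    exact OnePoint.coe_injective (MulAction.injective f h)
  have hUT : U ⊆ T := fun z hz => hz.1
  have h3 : 2 < (T \ U).ncard := by
    have := Set.le_ncard_sdiff U T (hTfin.subset hUT)
    omega
  obtain ⟨z₁, z₂, z₃, m1, m2, m3, h12, h13, h23⟩ :=
    (Set.two_lt_ncard_iff (hTfin.subset Set.sdiff_subset)).1 h3
  have key : ∀ z ∈ T \ U, ‖z‖ = 1 ∧ ‖a * z + b‖ = ‖c * z + d‖ := by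
    rintro z ⟨hz, hzU⟩
    have hz1 : ‖z‖ = 1 := norm_eq_one_of_pow_mem hn hS hz
    refine ⟨hz1, ?_⟩
    have hz0 : z ≠ 0 := by rintro rfl; simp at hz1
    have hmem : f • (z : Sphere) ∈ rotSet n E S :=
      (mem_stabilizer_smul_mem_iff hf _).2 ((coe_mem_rotSet hE hz0).2 hz)
    obtain ⟨w, hw, he⟩ := mem_rotSet_cases hmem (fun h => hzU ⟨hz, h⟩)
    rw [(mob_smul_coe_eq_coe_iff hdet).1 he |>.2, norm_mul, norm_eq_one_of_pow_mem hn hS hw, one_mul]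
  exact preservesCircle_of_three h12 h13 h23 (key _ m1).1 (key _ m2).1 (key _ m3).1
    (key _ m1).2 (key _ m2).2 (key _ m3).2

/-- A point of E leaving E would land on the circle; but the inverse also preserves the circle and
could not bring it back to a pole. -/
theorem smul_mem_of_mem_stabilizer {n : ℕ} (hn : n ≠ 0) {E : Set Sphere} (hE : E ⊆ poles)
    {S : Set ℂ} (hS : ∀ s ∈ S, ‖s‖ = 1) (hfin : S.Finite) (hcard : E.ncard + 3 ≤ n * S.ncard)
    {f : moebiusGroup} (hf : f ∈ moebiusStabilizer (rotSet n E S)) {x : Sphere} (hx : x ∈ E) :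
    f • x ∈ E := by
  by_contra hxE
  obtain ⟨w, hw, he⟩ :=
    mem_rotSet_cases ((mem_stabilizer_smul_mem_iff hf x).2 (Or.inl hx)) hxE
  have hinv := inv_mem hf
  have he' : f⁻¹ • (w : Sphere) = x := by rw [← he, inv_smul_smul]
  obtain ⟨a, b, c, d, hdet, hg⟩ := exists_eq_mob f⁻¹
  rw [hg] at hinv he'
  have hC := preservesCircle_of_mem_stabilizer hn hE hS hfin hcard hinv
  have hw1 := norm_eq_one_of_pow_mem hn hS hw
  have hd := hC.denom_ne_zero hdet hw1
  rw [mob_smul_coe_of_ne _ hd] at he'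
  subst he'
  rcases hE hx with h | h
  · exact OnePoint.coe_ne_infty _ h
  · have h1 : ‖(a * w + b) / (c * w + d)‖ = 1 := by
      rw [norm_div, hC.norm_eq hw1, div_self (norm_ne_zero_iff.2 hd)]
    rw [OnePoint.coe_injective h] at h1
    simp at h1

theorem PreservesCircle.isDilation {a b c d : ℂ} (h : PreservesCircle a b c d)
    (hdet : a * d - b * c ≠ 0) (hc : c = 0) : IsDilation (mob a b c d hdet) (a / d) := by
  subst hc
  have had : a * d ≠ 0 := by simpa using hdet
  have ha := left_ne_zero_of_mul had
  have hd := right_ne_zero_of_mul had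
  have hb : b = 0 := by
    have := h.2
    rw [zero_mul] at this
    simpa [ha] using this
  subst hb
  refine ⟨fun z => ?_, ?_⟩
  · rw [mob_smul_coe_of_ne _ (by simpa using hd)]
    congr 1
    ring
  · rw [mob_smul_infty, if_pos rfl]

theorem PreservesCircle.smul_eq_div {a b c d : ℂ} (h : PreservesCircle a b c d)
    (hdet : a * d - b * c ≠ 0) (hd : d = 0) :
    b / c ≠ 0 ∧ ∀ z : ℂ, z ≠ 0 → mob a b c d hdet • (z : Sphere) = ((b / c / z : ℂ) : Sphere) := by
  subst hd
  have hbc : b * c ≠ 0 := by simpa using hdet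
  have hb := left_ne_zero_of_mul hbc
  have hc := right_ne_zero_of_mul hbc
  have ha : a = 0 := by
    have := h.2
    rw [map_zero, mul_zero] at this
    simpa [hb] using this
  subst ha
  refine ⟨div_ne_zero hb hc, fun z hz => ?_⟩
  rw [mob_smul_coe_of_ne _ (by simpa using ⟨hc, hz⟩)]
  congr 1
  rw [zero_mul, zero_add, add_zero, div_div]

/-! ### Rigid finite subsets of the circle -/

/-- The points `exp (i j)`, `j ∈ J`. -/
def expSet (J : Finset ℕ) : Set ℂ := (fun j : ℕ => Complex.exp ((j : ℤ) * Complex.I)) '' J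

/-- A coincidence would make π rational. Multiplicative symmetries of the points thus become
symmetries of sets of integers. -/
theorem exp_intCast_mul_I_injective :
    Function.Injective fun j : ℤ => Complex.exp (j * Complex.I) := by
  intro j m h
  obtain ⟨l, hl⟩ := Complex.exp_eq_exp_iff_exists_int.1 h
  have h1 : (j : ℂ) = m + l * (2 * Real.pi) :=
    mul_right_cancel₀ Complex.I_ne_zero (by linear_combination hl)
  have h2 : (j : ℝ) = m + l * (2 * Real.pi) := by exact_mod_cast h1
  by_cases hl0 : l = 0
  · rw [hl0] at h2
    have h3 : (j : ℝ) = m := by simpa using h2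
    exact_mod_cast h3
  · exfalso
    apply irrational_pi
    refine ⟨(j - m) / (2 * l), ?_⟩
    have : (l : ℝ) ≠ 0 := by exact_mod_cast hl0
    push_cast
    field_simp
    linarith

theorem norm_of_mem_expSet {J : Finset ℕ} {s : ℂ} (hs : s ∈ expSet J) : ‖s‖ = 1 := by
  obtain ⟨j, -, rfl⟩ := hs
  simpa using Complex.norm_exp_ofReal_mul_I (j : ℝ)

theorem exp_mem_expSet {J : Finset ℕ} {m : ℤ} :
    Complex.exp (m * Complex.I) ∈ expSet J ↔ ∃ j ∈ J, (j : ℤ) = m := by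
  constructor
  · rintro ⟨j, hj, h⟩
    exact ⟨j, hj, exp_intCast_mul_I_injective h⟩
  · rintro ⟨j, hj, rfl⟩
    exact ⟨j, hj, rfl⟩

theorem finite_expSet (J : Finset ℕ) : (expSet J).Finite := J.finite_toSet.image _

theorem ncard_expSet (J : Finset ℕ) : (expSet J).ncard = J.card := by
  rw [expSet, Set.ncard_image_of_injective, Set.ncard_coe_finset]
  intro j m h
  exact_mod_cast exp_intCast_mul_I_injective h

/-- Multiplication by u translates J, and a nonempty finite set of integers has no nonzero
translation into itself: compare maximum and minimum. -/
theorem eq_one_of_mul_mem_expSet {J : Finset ℕ} (hJ : J.Nonempty) {u : ℂ}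
    (h : ∀ s ∈ expSet J, u * s ∈ expSet J) : u = 1 := by
  obtain ⟨M, hM, hmax⟩ := J.exists_max_image id hJ
  obtain ⟨m, hm, hmin⟩ := J.exists_min_image id hJ
  obtain ⟨i, hi, hiM⟩ := h _ ⟨M, hM, rfl⟩
  have hu : u = Complex.exp (((i - M : ℤ) : ℂ) * Complex.I) := by
    push_cast
    rw [sub_mul, Complex.exp_sub, eq_div_iff (Complex.exp_ne_zero _)]
    simpa using hiM.symm
  have hm2 := h _ ⟨m, hm, rfl⟩
  rw [hu] at hm2
  beta_reduce at hm2
  rw [← Complex.exp_add, ← add_mul, ← Int.cast_add, exp_mem_expSet] at hm2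
  obtain ⟨j, hj, hjm⟩ := hm2
  have h1 : m ≤ j := hmin j hj
  have h2 : i ≤ M := hmax i hi
  have h3 : (i : ℤ) - M = 0 := by omega
  rw [hu, h3]
  simp

/-- The exponents are {0, …, k-2, k}. Division would give a reflection j ↦ m - j; the images of 0
and k force m = k, and then 1 goes to the missing k - 1. -/
theorem exists_div_notMem_expSet {k : ℕ} (hk : 3 ≤ k) (u : ℂ) :
    ∃ s ∈ expSet (insert k (Finset.range (k - 1))),
      u / s ∉ expSet (insert k (Finset.range (k - 1))) := by
  by_contra! h
  obtain ⟨m, hm, hu⟩ := h _ ⟨0, by simp; omega, rfl⟩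
  have hu' : u = Complex.exp ((m : ℤ) * Complex.I) := by simpa using hu.symm
  have key : ∀ j ∈ insert k (Finset.range (k - 1)),
      ∃ i ∈ insert k (Finset.range (k - 1)), (i : ℤ) = m - j := by
    intro j hj
    have := h _ ⟨j, hj, rfl⟩
    beta_reduce at this
    rwa [hu', ← Complex.exp_sub, ← sub_mul, ← Int.cast_sub, exp_mem_expSet] at this
  obtain ⟨i, -, hi⟩ := key k (by simp)
  obtain ⟨j, hj, hj'⟩ := key 1 (by simp; omega)
  have hm : m = k ∨ m < k - 1 := by simpa using hm
  have hj : j = k ∨ j < k - 1 := by simpa using hj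
  omega

/-! ### The discriminant argument -/

/-- A Möbius transformation permuting a finite set preserves its discriminant. -/
theorem prod_norm_denom_sq_eq {a b c d : ℂ} (hdet : a * d - b * c ≠ 0) {T : Finset ℂ}
    (hT : 2 ≤ T.card) (hd : ∀ z ∈ T, c * z + d ≠ 0)
    (hmaps : ∀ z ∈ T, (a * z + b) / (c * z + d) ∈ T) :
    (∏ z ∈ T, ‖c * z + d‖) ^ 2 = ‖a * d - b * c‖ ^ T.card := by
  classical
  set g : ℂ → ℂ := fun z => (a * z + b) / (c * z + d) with hg
  set D := a * d - b * c with hD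
  set u : ℂ → ℝ := fun z => ‖c * z + d‖ with hu
  have hupos : ∀ z ∈ T, 0 < u z := fun z hz => norm_pos_iff.2 (hd z hz)
  -- (g x - g y)(c x + d)(c y + d) = D (x - y), in absolute values; multiplied over all pairs x ≠ y,
  -- the distances cancel.
  have hdiff : ∀ x ∈ T, ∀ y ∈ T, ‖g x - g y‖ * (u x * u y) = ‖D‖ * ‖x - y‖ := by
    intro x hx y hy
    have hx' := hd x hx
    have hy' := hd y hy
    rw [hu, ← norm_mul, ← norm_mul, ← norm_mul]
    congr 1
    rw [hg]
    beta_reduce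
    rw [div_sub_div _ _ hx' hy', div_mul_cancel₀ _ (mul_ne_zero hx' hy')]
    ring
  have hinj : Set.InjOn g T := by
    intro x hx y hy h
    have := hdiff x hx y hy
    rw [h, sub_self, norm_zero, zero_mul] at this
    have h2 : ‖x - y‖ = 0 := (mul_eq_zero.1 this.symm).resolve_left (norm_ne_zero_iff.2 hdet)
    exact sub_eq_zero.1 (norm_eq_zero.1 h2)
  have hmaps2 : Set.MapsTo (fun p : ℂ × ℂ => (g p.1, g p.2)) T.offDiag T.offDiag := by
    intro p hp
    rw [Finset.mem_coe, Finset.mem_offDiag] at hp ⊢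
    exact ⟨hmaps _ hp.1, hmaps _ hp.2.1, fun h => hp.2.2 (hinj hp.1 hp.2.1 h)⟩
  have hinj2 : Set.InjOn (fun p : ℂ × ℂ => (g p.1, g p.2)) T.offDiag := by
    intro p hp q hq h
    rw [Finset.mem_coe, Finset.mem_offDiag] at hp hq
    rw [Prod.mk.injEq] at h
    exact Prod.ext (hinj hp.1 hq.1 h.1) (hinj hp.2.1 hq.2.1 h.2)
  have hperm : ∏ p ∈ T.offDiag, ‖g p.1 - g p.2‖ = ∏ p ∈ T.offDiag, ‖p.1 - p.2‖ :=
    Finset.prod_nbij (fun p : ℂ × ℂ => (g p.1, g p.2)) hmaps2 hinj2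
      (Finset.surjOn_of_injOn_of_card_le _ hmaps2 hinj2 le_rfl) (fun _ _ => rfl)
  set P := ∏ p ∈ T.offDiag, ‖p.1 - p.2‖ with hP
  have hPpos : 0 < P := by
    refine Finset.prod_pos fun p hp => ?_
    rw [Finset.mem_offDiag] at hp
    exact norm_pos_iff.2 (sub_ne_zero.2 hp.2.2)
  set W := ∏ p ∈ T.offDiag, u p.1 * u p.2 with hW
  have hPW : P * W = ‖D‖ ^ (T.card * T.card - T.card) * P := by
    calc P * W = ∏ p ∈ T.offDiag, ‖g p.1 - g p.2‖ * (u p.1 * u p.2) := by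
          rw [Finset.prod_mul_distrib, hperm]
      _ = ∏ p ∈ T.offDiag, ‖D‖ * ‖p.1 - p.2‖ := by
          refine Finset.prod_congr rfl fun p hp => ?_
          rw [Finset.mem_offDiag] at hp
          exact hdiff _ hp.1 _ hp.2.1
      _ = ‖D‖ ^ (T.card * T.card - T.card) * P := by
          rw [Finset.prod_mul_distrib, Finset.prod_const, Finset.offDiag_card]
  have hWD : W = ‖D‖ ^ (T.card * T.card - T.card) :=
    mul_left_cancel₀ hPpos.ne' (by rw [hPW, mul_comm])
  -- Adding the diagonal turns the product over pairs x ≠ y into one over T × T. With N = |T| and X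
  -- the squared product, X^(N-1) = ‖D‖^(N(N-1)); since N ≥ 2, the (N-1)-th root may be taken.
  have hfull : (∏ z ∈ T, u z) ^ 2 * W = ((∏ z ∈ T, u z) ^ 2) ^ T.card := by
    have h1 : ∏ p ∈ T.diag, u p.1 * u p.2 = (∏ z ∈ T, u z) ^ 2 := by
      rw [Finset.prod_diag, Finset.prod_mul_distrib, sq]
    rw [hW, ← h1, ← Finset.prod_union (Finset.disjoint_diag_offDiag T), Finset.diag_union_offDiag,
      h1, Finset.prod_product]
    simp only [Finset.prod_mul_distrib, Finset.prod_const, Finset.prod_pow]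
    rw [← pow_mul, ← pow_add]
    ring
  set X := (∏ z ∈ T, u z) ^ 2 with hX
  have hXpos : 0 < X := pow_pos (Finset.prod_pos hupos) 2
  obtain ⟨m, hm⟩ : ∃ m, T.card = m + 2 := ⟨T.card - 2, by omega⟩
  rw [hWD, hm] at hfull
  rw [hm]
  have e1 : (m + 2) * (m + 2) - (m + 2) = (m + 2) * (m + 1) := by
    rw [Nat.sub_eq_of_eq_add]; ring
  rw [e1, pow_mul, pow_succ X (m + 1), mul_comm (X ^ (m + 1))] at hfull
  have h2 := mul_left_cancel₀ hXpos.ne' hfull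
  exact ((pow_left_inj₀ (by positivity) hXpos.le (by omega)).1 h2).symm

/-- For t^n = s this is the factorization of d^n - (-c t)^n over the n-th roots of unity. -/
theorem prod_denom_fiber {n : ℕ} (hn : n ≠ 0) {T : Finset ℂ} {s : ℂ} (hs : s ≠ 0)
    (hT : ∀ z, z ^ n = s → z ∈ T) (c d : ℂ) :
    ∏ z ∈ T with z ^ n = s, (c * z + d) = d ^ n - (-c) ^ n * s := by
  obtain ⟨t, rfl⟩ := IsAlgClosed.exists_pow_nat_eq s (Nat.pos_of_ne_zero hn)
  have ht : t ≠ 0 := by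
    rintro rfl
    exact hs (zero_pow hn)
  have h1 : (T.filter fun z => z ^ n = t ^ n) =
      (Polynomial.nthRootsFinset n (1 : ℂ)).image (fun ζ => ζ * t) := by
    ext z
    rw [← filter_pow_eq_image hn ht, Finset.mem_filter]
    exact ⟨fun h => h.2, fun h => ⟨hT z h, h⟩⟩
  rw [h1, Finset.prod_image (mul_left_injective₀ ht).injOn, ← mul_pow,
    (isPrimitiveRoot_rootOfUnity hn).pow_sub_pow_eq_prod_sub_mul _ _ (Nat.pos_of_ne_zero hn)]
  refine Finset.prod_congr rfl fun ζ _ => ?_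
  ring

theorem pow_add_pow_le_of_sq {u w v : ℝ} (hu : 0 ≤ u) (hw : 0 ≤ w) (hv : 0 ≤ v)
    (h : v ^ 2 = u ^ 2 + w ^ 2) {n : ℕ} (hn : 2 ≤ n) : u ^ n + w ^ n ≤ v ^ n := by
  have huv : u ≤ v := le_of_sq_le_sq (by nlinarith) hv
  have hwv : w ≤ v := le_of_sq_le_sq (by nlinarith) hv
  induction n, hn using Nat.le_induction with
  | base => exact h.ge
  | succ n _ ih =>
    calc u ^ (n + 1) + w ^ (n + 1) = u ^ n * u + w ^ n * w := by ring
      _ ≤ u ^ n * v + w ^ n * v := by gcongr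
      _ = (u ^ n + w ^ n) * v := by ring
      _ ≤ v ^ n * v := by gcongr
      _ = v ^ (n + 1) := by ring

/-- For u ≤ v put w² = v² - u². Then u^n + w^n ≤ v^n, that is, w^n ≤ v^n - u^n; square this. -/
theorem abs_sq_sub_sq_pow_le {u v : ℝ} (hu : 0 ≤ u) (hv : 0 ≤ v) {n : ℕ} (hn : 2 ≤ n) :
    |v ^ 2 - u ^ 2| ^ n ≤ (v ^ n - u ^ n) ^ 2 := by
  wlog huv : u ≤ v generalizing u v
  · have := this hv hu (le_of_not_ge huv)
    rwa [abs_sub_comm, ← neg_sub (v ^ n) (u ^ n), neg_sq] at this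
  have h0 : 0 ≤ v ^ 2 - u ^ 2 := sub_nonneg.2 (pow_le_pow_left₀ hu huv 2)
  rw [abs_of_nonneg h0]
  have hs := Real.sq_sqrt h0
  have hs0 := Real.sqrt_nonneg (v ^ 2 - u ^ 2)
  have h1 := pow_add_pow_le_of_sq hu hs0 hv (by rw [hs]; ring) hn
  rw [← hs, ← pow_mul, mul_comm 2 n, pow_mul]
  exact pow_le_pow_left₀ (pow_nonneg hs0 n) (by linarith) 2

theorem PreservesCircle.norm_det_eq {a b c d : ℂ} (h : PreservesCircle a b c d)
    (hdet : a * d - b * c ≠ 0) : ‖a * d - b * c‖ = |‖d‖ ^ 2 - ‖c‖ ^ 2| := by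
  obtain ⟨h1, h2⟩ := h
  have hprod : Complex.normSq a * Complex.normSq b = Complex.normSq c * Complex.normSq d := by
    have := congrArg Complex.normSq h2
    simpa [Complex.normSq_conj] using this
  have hD : Complex.normSq (a * d - b * c) =
      Complex.normSq a * Complex.normSq d + Complex.normSq b * Complex.normSq c -
        2 * (Complex.normSq c * Complex.normSq d) := by
    have h2' : conj a * b = conj c * d := by
      have := congrArg conj h2
      simpa using this
    have : ((Complex.normSq (a * d - b * c) : ℝ) : ℂ) =
      ((Complex.normSq a * Complex.normSq d + Complex.normSq b * Complex.normSq c -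
        2 * (Complex.normSq c * Complex.normSq d) : ℝ) : ℂ) := by
      push_cast
      simp only [← Complex.mul_conj, map_sub, map_mul]
      linear_combination (-(d * conj c)) * h2 - (c * conj d) * h2'
    exact_mod_cast this
  have hpos : Complex.normSq (a * d - b * c) ≠ 0 := fun h => hdet (Complex.normSq_eq_zero.1 h)
  rw [← abs_of_nonneg (norm_nonneg (a * d - b * c)), ← sq_eq_sq_iff_abs_eq_abs]
  simp only [← Complex.normSq_eq_norm_sq]
  rw [hD] at hpos ⊢
  generalize Complex.normSq a = A at *
  generalize Complex.normSq b = B at *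
  generalize Complex.normSq c = C at *
  generalize Complex.normSq d = E at *
  have hB : B = C + E - A := by linarith
  subst hB
  -- {A, B} and {C, E} have the same sum and product. The matching A = C makes the determinant zero,
  -- so A = E and B = C.
  have h3 : (A - C) * (A - E) = 0 := by linear_combination -hprod
  rcases mul_eq_zero.1 h3 with h | h
  · exfalso
    apply hpos
    linear_combination (E - C) * h
  · linear_combination (E - C) * h

/-- Equality in the reverse triangle inequality makes y s a positive multiple of x, which determines
s. -/
theorem norm_sub_mul_sq_lt {x y s₁ s₂ : ℂ} (hx : x ≠ 0) (hy : y ≠ 0) (h1 : ‖s₁‖ = 1)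
    (h2 : ‖s₂‖ = 1) (h12 : s₁ ≠ s₂) :
    (‖x‖ - ‖y‖) ^ 2 < ‖x - y * s₁‖ ^ 2 ∨ (‖x‖ - ‖y‖) ^ 2 < ‖x - y * s₂‖ ^ 2 := by
  have key : ∀ s : ℂ, ‖s‖ = 1 → ‖x - y * s‖ ^ 2 ≤ (‖x‖ - ‖y‖) ^ 2 →
      x * conj (y * s) = ((‖x‖ * ‖y‖ : ℝ) : ℂ) := by
    intro s hs hle
    have hn : ‖x * conj (y * s)‖ = ‖x‖ * ‖y‖ := by
      rw [norm_mul, Complex.norm_conj, norm_mul, hs, mul_one]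
    have h3 : ‖x - y * s‖ ^ 2 = ‖x‖ ^ 2 + ‖y‖ ^ 2 - 2 * (x * conj (y * s)).re := by
      rw [← Complex.normSq_eq_norm_sq, Complex.normSq_sub, Complex.normSq_eq_norm_sq,
        Complex.normSq_eq_norm_sq, norm_mul y s, hs, mul_one]
    have h4 : (x * conj (y * s)).re = ‖x * conj (y * s)‖ :=
      le_antisymm (Complex.re_le_norm _) (by rw [hn]; nlinarith)
    have h5 : (x * conj (y * s)).im = 0 :=
      Complex.abs_re_eq_norm.1 (by rw [h4, abs_of_nonneg (norm_nonneg _)])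
    apply Complex.ext
    · rw [h4, hn, Complex.ofReal_re]
    · rw [h5, Complex.ofReal_im]
  by_contra! hcon
  have e := (key s₁ h1 hcon.1).trans (key s₂ h2 hcon.2).symm
  have e2 := (starRingEnd ℂ).injective (mul_left_cancel₀ hx e)
  exact h12 (mul_left_cancel₀ hy e2)

theorem sq_norm_sub_norm_le {x y : ℂ} : (‖x‖ - ‖y‖) ^ 2 ≤ ‖x - y‖ ^ 2 := by
  rw [← sq_abs]
  exact pow_le_pow_left₀ (abs_nonneg _) (abs_norm_sub_norm_le x y) 2

/-- Grouping the discriminant identity by n-th powers gives ∏ ‖d^n - (-c)^n s‖² = ∏ ‖ad - bc‖^n over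
s ∈ S. Each left factor is at least (‖d‖^n - ‖c‖^n)², which is at least ‖ad - bc‖^n because ‖ad -
bc‖ = |‖d‖² - ‖c‖²|. If c d ≠ 0, the first inequality is strict for s₁ or s₂. -/
theorem eq_zero_or_eq_zero_of_maps_circle {n : ℕ} (hn : 2 ≤ n) {S : Set ℂ} (hfin : S.Finite)
    (hS : ∀ s ∈ S, ‖s‖ = 1) {s₁ s₂ : ℂ} (hs1 : s₁ ∈ S) (hs2 : s₂ ∈ S) (h12 : s₁ ≠ s₂)
    {a b c d : ℂ} (hdet : a * d - b * c ≠ 0) (h : PreservesCircle a b c d)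
    (hmaps : ∀ z : ℂ, z ^ n ∈ S → ((a * z + b) / (c * z + d)) ^ n ∈ S) : c = 0 ∨ d = 0 := by
  classical
  by_contra! hcd
  obtain ⟨hc, hd⟩ := hcd
  have hn0 : n ≠ 0 := by omega
  have h0 : (0 : ℂ) ∉ S := fun h => by simpa using hS 0 h
  have hTfin := finite_pow_mem hn0 hfin
  have hmemT : ∀ z, z ∈ hTfin.toFinset ↔ z ^ n ∈ S := fun z => by simp
  have hTcard : hTfin.toFinset.card = n * hfin.toFinset.card := by
    rw [← Set.ncard_eq_toFinset_card _ hTfin, ← Set.ncard_eq_toFinset_card _ hfin,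
      ncard_pow_mem hn0 h0 hfin]
  generalize hTfin.toFinset = T at hmemT hTcard
  have hScard : 2 ≤ hfin.toFinset.card :=
    Finset.one_lt_card.2 ⟨s₁, by simpa using hs1, s₂, by simpa using hs2, h12⟩
  have hdisc := prod_norm_denom_sq_eq hdet (T := T) (by rw [hTcard]; nlinarith)
    (fun z hz => h.denom_ne_zero hdet (norm_eq_one_of_pow_mem hn0 hS ((hmemT z).1 hz)))
    (fun z hz => (hmemT _).2 (hmaps z ((hmemT z).1 hz)))
  have hfib : ∏ z ∈ T, ‖c * z + d‖ = ∏ s ∈ hfin.toFinset, ‖d ^ n - (-c) ^ n * s‖ := by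
    rw [← Finset.prod_fiberwise_of_maps_to (g := fun z => z ^ n) (t := hfin.toFinset)
      (fun z hz => by simpa using (hmemT z).1 hz)]
    refine Finset.prod_congr rfl fun s hs => ?_
    have hs' : s ∈ S := by simpa using hs
    rw [← norm_prod, prod_denom_fiber hn0 (fun h => h0 (h ▸ hs'))
      (fun z hz => (hmemT z).2 (hz ▸ hs'))]
  rw [hfib, ← Finset.prod_pow, hTcard, pow_mul, ← Finset.prod_const] at hdisc
  have hbound : ‖a * d - b * c‖ ^ n ≤ (‖d ^ n‖ - ‖(-c) ^ n‖) ^ 2 := by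
    rw [h.norm_det_eq hdet, norm_pow, norm_pow, norm_neg]
    exact abs_sq_sub_sq_pow_le (norm_nonneg _) (norm_nonneg _) hn
  refine absurd hdisc (ne_of_gt ?_)
  refine Finset.prod_lt_prod (fun s _ => pow_pos (norm_pos_iff.2 hdet) n) (fun s hs => ?_) ?_
  · have hs' : s ∈ S := by simpa using hs
    refine hbound.trans ?_
    have := sq_norm_sub_norm_le (x := d ^ n) (y := (-c) ^ n * s)
    rwa [norm_mul _ s, hS s hs', mul_one] at this
  · rcases norm_sub_mul_sq_lt (pow_ne_zero n hd) (pow_ne_zero n (neg_ne_zero.2 hc)) (hS _ hs1)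
      (hS _ hs2) h12 with hlt | hlt
    · exact ⟨s₁, by simpa using hs1, hbound.trans_lt hlt⟩
    · exact ⟨s₂, by simpa using hs2, hbound.trans_lt hlt⟩

/-! ### Existence of sets with prescribed index -/

/-- Among circle-preserving maps, c = 0 gives a dilation and d = 0 an inversion. When E contains 0,
the image of 0 decides which; when E is empty, the discriminant does. -/
theorem stabilizer_rotSet_cases {n : ℕ} (hn : 2 ≤ n) {E : Set Sphere} (hE : E ⊆ poles)
    {S : Set ℂ} (hS : ∀ s ∈ S, ‖s‖ = 1) (hfin : S.Finite) (hcard : E.ncard + 3 ≤ n * S.ncard)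
    (hcase : E = {((0 : ℂ) : Sphere)} ∨ ((E = ∅ ∨ E = poles) ∧ 2 ≤ S.ncard))
    {f : moebiusGroup} (hf : f ∈ moebiusStabilizer (rotSet n E S)) :
    (∃ e : ℂ, IsDilation f e ∧ ∀ s ∈ S, e ^ n * s ∈ S) ∨
      ((E = ∅ ∨ E = poles) ∧ ∃ u : ℂ, ∀ s ∈ S, u / s ∈ S) := by
  have hn0 : n ≠ 0 := by omega
  have hpos := Nat.pos_of_ne_zero hn0
  obtain ⟨a, b, c, d, hdet, rfl⟩ := exists_eq_mob f
  have hC := preservesCircle_of_mem_stabilizer hn0 hE hS hfin hcard hf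
  have hne : ∀ {z : ℂ}, z ^ n ∈ S → z ≠ 0 := by
    rintro z hz rfl
    have := norm_eq_one_of_pow_mem hn0 hS hz
    simp at this
  have hmem : ∀ {z w : ℂ}, z ^ n ∈ S → w ≠ 0 →
      mob a b c d hdet • (z : Sphere) = (w : Sphere) → w ^ n ∈ S := by
    intro z w hz hw he
    rw [← coe_mem_rotSet hE hw, ← he, mem_stabilizer_smul_mem_iff hf, coe_mem_rotSet hE (hne hz)]
    exact hz
  have hdil : c = 0 → ∃ e : ℂ, IsDilation (mob a b c d hdet) e ∧ ∀ s ∈ S, e ^ n * s ∈ S := by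
    intro hc
    have hD := hC.isDilation hdet hc
    refine ⟨a / d, hD, fun s hs => ?_⟩
    obtain ⟨z, rfl⟩ := IsAlgClosed.exists_pow_nat_eq s hpos
    rw [← mul_pow]
    exact hmem hs (mul_ne_zero (isDilation_ne_zero hD) (hne hs)) (hD.1 z)
  have hinv : d = 0 → ∃ u : ℂ, ∀ s ∈ S, u / s ∈ S := by
    intro hd
    obtain ⟨he, hz⟩ := hC.smul_eq_div hdet hd
    refine ⟨(b / c) ^ n, fun s hs => ?_⟩
    obtain ⟨z, rfl⟩ := IsAlgClosed.exists_pow_nat_eq s hpos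
    rw [← div_pow]
    exact hmem hs (div_ne_zero he (hne hs)) (hz z (hne hs))
  have hzero : mob a b c d hdet • ((0 : ℂ) : Sphere) = ((0 : ℂ) : Sphere) → c = 0 := by
    intro h
    obtain ⟨h1, h2⟩ := (mob_smul_coe_eq_coe_iff hdet).1 h
    have hb : b = 0 := by linear_combination h2
    have hd : d ≠ 0 := by simpa using h1
    have := hC.2
    rw [hb, map_zero, mul_zero] at this
    simpa [hd] using this.symm
  rcases hcase with rfl | ⟨rfl | rfl, h2⟩
  · exact Or.inl (hdil (hzero (smul_mem_of_mem_stabilizer hn0 hE hS hfin hcard hf rfl)))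
  · obtain ⟨s₁, hs1, s₂, hs2, h12⟩ := (Set.one_lt_ncard hfin).1 h2
    have hmaps : ∀ z : ℂ, z ^ n ∈ S → ((a * z + b) / (c * z + d)) ^ n ∈ S := by
      intro z hz
      have hz1 := norm_eq_one_of_pow_mem hn0 hS hz
      have hd := hC.denom_ne_zero hdet hz1
      refine hmem hz ?_ (mob_smul_coe_of_ne hdet hd)
      rw [← norm_ne_zero_iff, norm_div, hC.norm_eq hz1, div_self (norm_ne_zero_iff.2 hd)]
      exact one_ne_zero
    rcases eq_zero_or_eq_zero_of_maps_circle hn hfin hS hs1 hs2 h12 hdet hC hmaps with h | h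
    · exact Or.inl (hdil h)
    · exact Or.inr ⟨Or.inl rfl, hinv h⟩
  · rcases smul_mem_of_mem_stabilizer hn0 hE hS hfin hcard hf (x := ((0 : ℂ) : Sphere))
      (Or.inr rfl) with h | h
    · refine Or.inr ⟨Or.inr rfl, hinv ?_⟩
      by_contra hd
      rw [mob_smul_coe_of_ne _ (by simpa using hd)] at h
      exact OnePoint.coe_ne_infty _ h
    · exact Or.inl (hdil (hzero h))

theorem exists_stabilizer_eq_of_expSet {n : ℕ} (hn : 2 ≤ n) {E : Set Sphere} (hE : E ⊆ poles)
    {J : Finset ℕ} (hJ : J.Nonempty) (hcard : E.ncard + 3 ≤ n * J.card)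
    (hcase : E = {((0 : ℂ) : Sphere)} ∨ ((E = ∅ ∨ E = poles) ∧ 2 ≤ J.card ∧
      ∀ u : ℂ, ∃ s ∈ expSet J, u / s ∉ expSet J)) :
    ∃ α : Set Sphere, α.Finite ∧ moebiusStabilizer α = rotationGroup n ∧
      cyclicIndex n α = (E.ncard, J.card) := by
  have hn0 : n ≠ 0 := by omega
  have hS : ∀ s ∈ expSet J, ‖s‖ = 1 := fun s hs => norm_of_mem_expSet hs
  have h0 : (0 : ℂ) ∉ expSet J := fun h => by simpa using hS 0 h
  have hfin := finite_expSet J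
  refine ⟨rotSet n E (expSet J), finite_rotSet hn0 hE hfin, ?_, ?_⟩
  · refine le_antisymm (fun f hf => ?_) (rotationGroup_le_stabilizer_rotSet hn0 hE hfin)
    rcases stabilizer_rotSet_cases hn hE hS hfin (by rwa [ncard_expSet])
      (hcase.imp_right fun h => ⟨h.1, by rw [ncard_expSet]; exact h.2.1⟩) hf with
      ⟨e, he, hmul⟩ | ⟨hE', u, hu⟩
    · exact (mem_rotationGroup_iff hn0).2 ⟨e, eq_one_of_mul_mem_expSet hJ hmul, he⟩
    · exfalso
      rcases hcase with rfl | ⟨-, -, h⟩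
      · rcases hE' with h | h
        · exact Set.singleton_ne_empty _ h
        · have := congrArg Set.ncard h
          rw [ncard_poles, Set.ncard_singleton] at this
          omega
      · obtain ⟨s, hs, hs'⟩ := h u
        exact hs' (hu s hs)
  · rw [cyclicIndex_rotSet hn0 hE h0, ncard_expSet]

theorem exists_stabilizer_eq_rotationGroup {n : ℕ} (hn : 2 ≤ n) {ν k : ℕ} (hν : ν ≤ 2)
    (h : 3 ≤ k ∨ (ν = 1 ∧ k = 2) ∨ (4 ≤ n ∧ ν = 1 ∧ k = 1)) :
    ∃ α : Set Sphere, α.Finite ∧ moebiusStabilizer α = rotationGroup n ∧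
      cyclicIndex n α = (ν, k) := by
  have hE1 : ({((0 : ℂ) : Sphere)} : Set Sphere) ⊆ poles := by rintro x rfl; exact Or.inr rfl
  rcases h with hk | ⟨rfl, rfl⟩ | ⟨hn4, rfl, rfl⟩
  · have hJ : (insert k (Finset.range (k - 1))).card = k := by
      rw [Finset.card_insert_of_notMem (by simp), Finset.card_range]; omega
    have h6 : 6 ≤ n * k := Nat.mul_le_mul hn hk
    have hdiv := exists_div_notMem_expSet hk
    interval_cases ν
    · have := exists_stabilizer_eq_of_expSet hn (Set.empty_subset _) (Finset.insert_nonempty _ _)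
        (by rw [hJ, Set.ncard_empty]; omega)
        (Or.inr ⟨Or.inl rfl, by rw [hJ]; omega, hdiv⟩)
      rwa [hJ, Set.ncard_empty] at this
    · have := exists_stabilizer_eq_of_expSet (J := insert k (Finset.range (k - 1))) hn hE1
        (Finset.insert_nonempty _ _) (by rw [hJ, Set.ncard_singleton]; omega) (Or.inl rfl)
      rwa [hJ, Set.ncard_singleton] at this
    · have := exists_stabilizer_eq_of_expSet hn subset_rfl (Finset.insert_nonempty _ _)
        (by rw [hJ, ncard_poles]; omega)
        (Or.inr ⟨Or.inr rfl, by rw [hJ]; omega, hdiv⟩)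
      rwa [hJ, ncard_poles] at this
  -- For E = {0} inversions are excluded, so any nonempty J works once 4 ≤ n |J|: n ≥ 2 suffices for
  -- |J| = 2, while |J| = 1 needs n ≥ 4.
  · have := exists_stabilizer_eq_of_expSet (J := Finset.range 2) hn hE1 (by simp)
      (by rw [Finset.card_range, Set.ncard_singleton]; omega) (Or.inl rfl)
    rwa [Finset.card_range, Set.ncard_singleton] at this
  · have := exists_stabilizer_eq_of_expSet (J := Finset.range 1) hn hE1 (by simp)
      (by rw [Finset.card_range, Set.ncard_singleton]; omega) (Or.inl rfl)
    rwa [Finset.card_range, Set.ncard_singleton] at this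

/-! ### The symmetric integers -/

/-- On the branch j > p of the hyperbola, g is strictly decreasing and convex, so g 0 - g 1 > g 1 -
g 2 ≥ 1. The integer g 1 + 1 lies strictly between g 1 and g 0, so it could be attained only at an i
with 0 < i < 1. -/
theorem not_mul_eq_const_of_neg_of_pos {k : ℤ} (hk : 2 ≤ k) {g : ℤ → ℤ}
    (hmaps : ∀ j, |j| ≤ k → |g j| ≤ k) (hsurj : ∀ m, |m| ≤ k → ∃ i, |i| ≤ k ∧ g i = m)
    {p A B : ℝ} (hp : p < 0) (hB : 0 < B) :
    ¬ ∀ j : ℤ, |j| ≤ k → ((j : ℝ) - p) * (g j - A) = B := by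
  intro h
  have a0 : |(0 : ℤ)| ≤ k := by simp; omega
  have a1 : |(1 : ℤ)| ≤ k := by simp; omega
  have a2 : |(2 : ℤ)| ≤ k := by simpa using hk
  have h0 := h 0 a0
  have h1 := h 1 a1
  have h2 := h 2 a2
  push_cast at h0 h1 h2
  have p1 : 0 < (g 1 : ℝ) - A := pos_of_mul_pos_right (h1 ▸ hB) (by linarith)
  have p2 : 0 < (g 2 : ℝ) - A := pos_of_mul_pos_right (h2 ▸ hB) (by linarith)
  have h21 : (g 2 : ℝ) < g 1 := by
    by_contra! hle
    nlinarith
  have h21' : (g 2 : ℝ) + 1 ≤ g 1 := by exact_mod_cast h21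
  have h10 : (g 1 : ℝ) + 1 < g 0 := by
    by_contra! hle
    nlinarith
  have h10' : g 1 + 1 < g 0 := by exact_mod_cast h10
  have m0 := abs_le.1 (hmaps 0 a0)
  have m1 := abs_le.1 (hmaps 1 a1)
  obtain ⟨i, hi, hgi⟩ := hsurj (g 1 + 1) (abs_le.2 ⟨by omega, by omega⟩)
  have h3 := h i hi
  rw [hgi] at h3
  push_cast at h3
  have hip : 0 < (i : ℝ) - p := pos_of_mul_pos_left (h3 ▸ hB) (by linarith)
  have i1 : (i : ℝ) < 1 := by
    by_contra! hle
    nlinarith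
  have i0 : (0 : ℝ) < i := by
    by_contra! hle
    nlinarith
  have i1' : i < 1 := by exact_mod_cast i1
  have i0' : 0 < i := by exact_mod_cast i0
  omega

theorem not_mul_eq_const {k : ℤ} (hk : 2 ≤ k) {g : ℤ → ℤ}
    (hmaps : ∀ j, |j| ≤ k → |g j| ≤ k) (hsurj : ∀ m, |m| ≤ k → ∃ i, |i| ≤ k ∧ g i = m)
    {p A B : ℝ} (hB : B ≠ 0) :
    ¬ ∀ j : ℤ, |j| ≤ k → ((j : ℝ) - p) * (g j - A) = B := by
  intro h
  have hp : p ≠ 0 := by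
    rintro rfl
    have := h 0 (by simp; omega)
    simp at this
    exact hB this.symm
  -- The reflections j ↦ -j and g ↦ -g change the signs of p and B.
  wlog hp' : p < 0 generalizing g p B
  · refine this (g := fun j => g (-j)) (p := -p) (B := -B) (fun j hj => hmaps _ (by rwa [abs_neg]))
      (fun m hm => ?_) (neg_ne_zero.2 hB) (fun j hj => ?_) (neg_ne_zero.2 hp) ?_
    · obtain ⟨i, hi, rfl⟩ := hsurj m hm
      exact ⟨-i, by rwa [abs_neg], by rw [neg_neg]⟩
    · have := h (-j) (by rwa [abs_neg])
      push_cast at this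
      linarith
    · have := lt_of_le_of_ne (not_lt.1 hp') hp.symm
      linarith
  wlog hB' : 0 < B generalizing g A B
  · refine this (g := fun j => -g j) (A := -A) (B := -B)
      (fun j hj => by rw [abs_neg]; exact hmaps j hj)
      (fun m hm => ?_) (neg_ne_zero.2 hB) (fun j hj => ?_) ?_
    · obtain ⟨i, hi, him⟩ := hsurj (-m) (by rwa [abs_neg])
      exact ⟨i, hi, by rw [him, neg_neg]⟩
    · have := h j hj
      push_cast
      linarith
    · have := lt_of_le_of_ne (not_lt.1 hB') hB
      linarith
  exact not_mul_eq_const_of_neg_of_pos hk hmaps hsurj hp' hB' h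

theorem eq_zero_of_forall_mul_eq {k : ℤ} (hk : 2 ≤ k) {g : ℤ → ℤ}
    (hmaps : ∀ j, |j| ≤ k → |g j| ≤ k) (hsurj : ∀ m, |m| ≤ k → ∃ i, |i| ≤ k ∧ g i = m)
    (hinj : ∀ i j, |i| ≤ k → |j| ≤ k → g i = g j → i = j) {a b c d : ℂ}
    (h : ∀ j : ℤ, |j| ≤ k → (g j : ℂ) * (c * j + d) = a * j + b) : c = 0 := by
  by_contra hc
  -- As j and g j are real, dividing by c and taking real parts yields a real hyperbola.
  have hre : ∀ j : ℤ, |j| ≤ k →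
      ((j : ℝ) - -(d / c).re) * (g j - (a / c).re) =
        (b / c).re - (a / c).re * (d / c).re := by
    intro j hj
    have h1 : (g j : ℂ) * (j + d / c) = a / c * j + b / c := by
      have := h j hj
      field_simp
      linear_combination this
    have h2 := congrArg Complex.re h1
    have e1 : ((g j : ℂ) * (j + d / c)).re = g j * (j + (d / c).re) := by simp
    have e2 : (a / c * j + b / c).re = (a / c).re * j + (b / c).re := by simp
    rw [e1, e2] at h2
    linear_combination h2
  -- If the hyperbola degenerates to two lines, each of j = 0, 1, 2 lies on j = p or on g j = A. By
  -- injectivity each line holds at most one of them, which is impossible for three.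
  by_cases hB : (b / c).re - (a / c).re * (d / c).re = 0
  · have key : ∀ j : ℤ, |j| ≤ k → (j : ℝ) = -(d / c).re ∨ (g j : ℝ) = (a / c).re := by
      intro j hj
      have := hre j hj
      rw [hB] at this
      exact (mul_eq_zero.1 this).imp sub_eq_zero.1 sub_eq_zero.1
    have a0 : |(0 : ℤ)| ≤ k := by simp; omega
    have a1 : |(1 : ℤ)| ≤ k := by simp; omega
    have a2 : |(2 : ℤ)| ≤ k := by simpa using hk
    have hne : ∀ i j : ℤ, |i| ≤ k → |j| ≤ k → i ≠ j → (g i : ℝ) = (a / c).re →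
        (g j : ℝ) ≠ (a / c).re := by
      intro i j hi hj hij h1 h2
      exact hij (hinj i j hi hj (by exact_mod_cast h1.trans h2.symm))
    have hne' : ∀ i j : ℤ, i ≠ j → (i : ℝ) = -(d / c).re → (j : ℝ) ≠ -(d / c).re := by
      intro i j hij h1 h2
      exact hij (by exact_mod_cast h1.trans h2.symm)
    rcases key 0 a0 with k0 | k0 <;> rcases key 1 a1 with k1 | k1 <;>
      rcases key 2 a2 with k2 | k2
    · exact hne' 0 1 (by norm_num) k0 k1
    · exact hne' 0 1 (by norm_num) k0 k1
    · exact hne' 0 2 (by norm_num) k0 k2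
    · exact hne 1 2 a1 a2 (by norm_num) k1 k2
    · exact hne' 1 2 (by norm_num) k1 k2
    · exact hne 0 2 a0 a2 (by norm_num) k0 k2
    · exact hne 0 1 a0 a1 (by norm_num) k0 k1
    · exact hne 0 1 a0 a1 (by norm_num) k0 k1
  · exact not_mul_eq_const hk hmaps hsurj hB hre

theorem zero_subset_poles : ({((0 : ℂ) : Sphere)} : Set Sphere) ⊆ poles := by
  rintro x rfl
  exact Or.inr rfl

theorem symmetricIntegers_eq_rotSet (k : ℕ) :
    symmetricIntegers k = rotSet 2 {((0 : ℂ) : Sphere)}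
      ((fun m : ℕ => (m : ℂ) ^ 2) '' (Finset.Icc 1 k)) := by
  ext x
  constructor
  · rintro ⟨j, hj, rfl⟩
    by_cases hj0 : j = 0
    · left; rw [hj0]; simp
    · refine (coe_mem_rotSet zero_subset_poles (by exact_mod_cast hj0)).2 ⟨j.natAbs, ?_, ?_⟩
      · rw [Int.abs_eq_natAbs] at hj
        simp only [Finset.coe_Icc, Set.mem_Icc]
        omega
      · have : ((j.natAbs : ℤ) : ℂ) ^ 2 = (j : ℂ) ^ 2 := by
          exact_mod_cast Int.natAbs_sq j
        simpa using this
  · rintro (rfl | ⟨z, ⟨-, m, hm, hmz⟩, rfl⟩)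
    · exact ⟨0, by simp, by simp⟩
    · have hm' : 1 ≤ m ∧ m ≤ k := by simpa using hm
      rcases sq_eq_sq_iff_eq_or_eq_neg.1 hmz with h | h
      · exact ⟨m, by simpa using hm'.2, by simp [h]⟩
      · refine ⟨-m, by simpa using hm'.2, ?_⟩
        rw [show z = -m by rw [h, neg_neg]]
        simp

theorem zero_notMem_image_sq (k : ℕ) :
    (0 : ℂ) ∉ (fun m : ℕ => (m : ℂ) ^ 2) '' (Finset.Icc 1 k) := by
  rintro ⟨m, hm, h⟩
  have hm' : 1 ≤ m ∧ m ≤ k := by simpa using hm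
  have : m = 0 := by simpa using h
  omega

theorem cyclicIndex_symmetricIntegers (k : ℕ) : cyclicIndex 2 (symmetricIntegers k) = (1, k) := by
  rw [symmetricIntegers_eq_rotSet, cyclicIndex_rotSet two_ne_zero zero_subset_poles
    (zero_notMem_image_sq k), Set.ncard_singleton, Set.ncard_image_of_injective,
    Set.ncard_coe_finset, Nat.card_Icc, Nat.add_sub_cancel]
  intro i j h
  beta_reduce at h
  have h2 : i ^ 2 = j ^ 2 := by exact_mod_cast h
  exact Nat.pow_left_injective two_ne_zero h2

theorem finite_symmetricIntegers (k : ℕ) : (symmetricIntegers k).Finite := by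
  rw [symmetricIntegers_eq_rotSet]
  exact finite_rotSet two_ne_zero zero_subset_poles ((Finset.finite_toSet _).image _)

theorem coe_intCast_mem_symmetricIntegers {k : ℕ} {j : ℤ} :
    ((j : ℂ) : Sphere) ∈ symmetricIntegers k ↔ |j| ≤ k := by
  constructor
  · rintro ⟨i, hi, h⟩
    have : j = i := by exact_mod_cast OnePoint.coe_injective h
    rwa [this]
  · intro h
    exact ⟨j, h, rfl⟩

theorem stabilizer_symmetricIntegers {k : ℕ} (hk : 2 ≤ k) :
    moebiusStabilizer (symmetricIntegers k) = rotationGroup 2 := by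
  refine le_antisymm (fun f hf => ?_) ?_
  · have hk' : (2 : ℤ) ≤ k := by exact_mod_cast hk
    have hmem := mem_stabilizer_smul_mem_iff hf
    have hex : ∀ j : ℤ, ∃ m : ℤ, |j| ≤ (k : ℤ) →
        |m| ≤ (k : ℤ) ∧ f • ((j : ℂ) : Sphere) = ((m : ℂ) : Sphere) := by
      intro j
      by_cases hj : |j| ≤ (k : ℤ)
      · obtain ⟨m, hm, h⟩ := (hmem _).2 (coe_intCast_mem_symmetricIntegers.2 hj)
        exact ⟨m, fun _ => ⟨hm, h⟩⟩
      · exact ⟨0, fun h => absurd h hj⟩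
    choose g hg using hex
    have hmaps : ∀ j, |j| ≤ (k : ℤ) → |g j| ≤ (k : ℤ) := fun j hj => (hg j hj).1
    have hinj : ∀ i j, |i| ≤ (k : ℤ) → |j| ≤ (k : ℤ) → g i = g j → i = j := by
      intro i j hi hj h
      have h2 : f • ((i : ℂ) : Sphere) = f • ((j : ℂ) : Sphere) := by
        rw [(hg i hi).2, (hg j hj).2, h]
      exact_mod_cast OnePoint.coe_injective (MulAction.injective f h2)
    have hsurj : ∀ m, |m| ≤ (k : ℤ) → ∃ i, |i| ≤ (k : ℤ) ∧ g i = m := by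
      intro m hm
      obtain ⟨i, hi, h⟩ :=
        (mem_stabilizer_smul_mem_iff (inv_mem hf) _).2 (coe_intCast_mem_symmetricIntegers.2 hm)
      rw [inv_smul_eq_iff, (hg i hi).2] at h
      exact ⟨i, hi, by exact_mod_cast (OnePoint.coe_injective h).symm⟩
    obtain ⟨a, b, c, d, hdet, rfl⟩ := exists_eq_mob f
    have hc : c = 0 := eq_zero_of_forall_mul_eq hk' hmaps hsurj hinj fun j hj =>
      ((mob_smul_coe_eq_coe_iff hdet).1 (hg j hj).2).2.symm
    have hinf : mob a b c d hdet • (OnePoint.infty : Sphere) = OnePoint.infty := by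
      rw [mob_smul_infty, if_pos hc]
    obtain ⟨A, B, -, hAB⟩ := exists_affine_of_fixes_infty hinf
    have hgA : ∀ j : ℤ, |j| ≤ (k : ℤ) → (g j : ℂ) = A * j + B := fun j hj =>
      OnePoint.coe_injective ((hg j hj).2.symm.trans (hAB j))
    have a0 : |(0 : ℤ)| ≤ k := by simp
    have a1 : |(1 : ℤ)| ≤ k := by simp; omega
    have hB : B = g 0 := by rw [hgA 0 a0]; simp
    have hA : A = (g 1 - g 0 : ℤ) := by rw [Int.cast_sub, hgA 1 a1, hgA 0 a0]; simp
    have hne : g 1 - g 0 ≠ 0 := fun h =>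
      absurd (hinj 1 0 a1 a0 (sub_eq_zero.1 h)) one_ne_zero
    have hlin : ∀ j : ℤ, |j| ≤ (k : ℤ) → |(g 1 - g 0) * j + g 0| ≤ (k : ℤ) := by
      intro j hj
      have : (g j : ℂ) = (((g 1 - g 0) * j + g 0 : ℤ) : ℂ) := by
        rw [hgA j hj, hA, hB]; push_cast; ring
      rw [← Int.cast_injective this]
      exact hmaps j hj
    -- The affine map has integer coefficients. The bounds at the endpoints ±k force the slope to be
    -- ±1, and then the constant term to be 0.
    have l1 := abs_le.1 (hlin k (by simp))
    have l2 := abs_le.1 (hlin (-k) (by simp))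
    have hu : (g 1 - g 0) ^ 2 = 1 ∧ g 0 = 0 := by
      generalize g 1 - g 0 = u at hne l1 l2
      have u1 : u ≤ 1 := by
        by_contra! h
        nlinarith
      have u2 : -1 ≤ u := by
        by_contra! h
        nlinarith
      have u3 : u = 1 ∨ u = -1 := by omega
      rcases u3 with rfl | rfl
      · exact ⟨by norm_num, by omega⟩
      · exact ⟨by norm_num, by omega⟩
    refine (mem_rotationGroup_iff two_ne_zero).2 ⟨A, ?_, fun z => ?_, hinf⟩
    · rw [hA]; exact_mod_cast hu.1
    · rw [hAB, hB, hu.2, Int.cast_zero, add_zero]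
  · rw [symmetricIntegers_eq_rotSet]
    exact rotationGroup_le_stabilizer_rotSet two_ne_zero zero_subset_poles
      ((Finset.finite_toSet _).image _)

/-! ### The table and the possible sizes -/

theorem table_of_stabilizer_mulEquiv {n : ℕ} (hn : 2 ≤ n) {ν k : ℕ} (hν : ν ≤ 2) :
    (∃ α : Set Sphere, α.Finite ∧ Nonempty (moebiusStabilizer α ≃* Multiplicative (ZMod n)) ∧
        HasCyclicIndex n α (ν, k)) ↔
      (3 ≤ k ∨ (ν = 1 ∧ k = 2) ∨ (4 ≤ n ∧ ν = 1 ∧ k = 1)) := by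
  constructor
  · rintro ⟨α, hfin, -, φ, hφ, hi⟩
    exact index_of_stabilizer_eq_rotationGroup hn hfin.smul_set hφ hν hi
  · intro h
    obtain ⟨α, hfin, hα, hi⟩ := exists_stabilizer_eq_rotationGroup hn hν h
    refine ⟨α, hfin, ?_, 1, by rwa [one_smul], by rwa [one_smul]⟩
    rw [hα]
    exact nonempty_rotationGroup_mulEquiv (by omega)

theorem exists_ncard_eq_iff {n : ℕ} (hn : 2 ≤ n) {m : ℕ} :
    (∃ α : Set Sphere, α.Finite ∧
        Nonempty (moebiusStabilizer α ≃* Multiplicative (ZMod n)) ∧ α.ncard = m) ↔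
      ∃ ν k : ℕ, ν ≤ 2 ∧ (3 ≤ k ∨ (ν = 1 ∧ k = 2) ∨ (4 ≤ n ∧ ν = 1 ∧ k = 1)) ∧
        m = ν + n * k := by
  constructor
  · rintro ⟨α, hfin, e, rfl⟩
    obtain ⟨⟨ν, k⟩, hq, hν, hc⟩ := exists_unique_cyclicIndex hn hfin e
    exact ⟨ν, k, hν, (table_of_stabilizer_mulEquiv hn hν).1 ⟨α, hfin, e, (hq _).2 rfl⟩, hc⟩
  · rintro ⟨ν, k, hν, h, rfl⟩
    obtain ⟨α, hfin, e, hi⟩ := (table_of_stabilizer_mulEquiv hn hν).2 h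
    obtain ⟨p, hq, -, hc⟩ := exists_unique_cyclicIndex hn hfin e
    obtain rfl := (hq _).1 hi
    exact ⟨α, hfin, e, hc⟩

theorem mainTheorem11 (n : ℕ) (hn : 2 ≤ n) :
    -- every finite set with stabilizer isomorphic to `ℤ/n` has a well-defined component index,
    -- and this index determines its size
    (∀ α : Set Sphere, α.Finite →
      Nonempty (moebiusStabilizer α ≃* Multiplicative (ZMod n)) →
      ∃ p : ℕ × ℕ, (∀ q : ℕ × ℕ, HasCyclicIndex n α q ↔ q = p) ∧
        p.1 ≤ 2 ∧ α.ncard = p.1 + n * p.2) ∧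
    -- the table, for stabilizers isomorphic to `ℤ/n`
    (∀ ν k : ℕ, ν ≤ 2 →
      ((∃ α : Set Sphere, α.Finite ∧
          Nonempty (moebiusStabilizer α ≃* Multiplicative (ZMod n)) ∧
          HasCyclicIndex n α (ν, k)) ↔
        (3 ≤ k ∨ (ν = 1 ∧ k = 2) ∨ (4 ≤ n ∧ ν = 1 ∧ k = 1)))) ∧
    -- the table, for stabilizers equal to the standard cyclic group
    (∀ ν k : ℕ, ν ≤ 2 →
      ((∃ α : Set Sphere, α.Finite ∧ moebiusStabilizer α = rotationGroup n ∧
          cyclicIndex n α = (ν, k)) ↔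
        (3 ≤ k ∨ (ν = 1 ∧ k = 2) ∨ (4 ≤ n ∧ ν = 1 ∧ k = 1)))) ∧
    -- all possible sizes
    (4 ≤ n →
      {m : ℕ | ∃ α : Set Sphere, α.Finite ∧
          Nonempty (moebiusStabilizer α ≃* Multiplicative (ZMod n)) ∧ α.ncard = m} =
        {m : ℕ | ∃ x ∈ ({0, 1, 2} : Set ℕ), ∃ k : ℕ, 3 ≤ k ∧ m = x + n * k} ∪
          {1 + n, 1 + 2 * n}) ∧
    (n = 2 ∨ n = 3 →
      {m : ℕ | ∃ α : Set Sphere, α.Finite ∧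
          Nonempty (moebiusStabilizer α ≃* Multiplicative (ZMod n)) ∧ α.ncard = m} =
        {m : ℕ | ∃ x ∈ ({0, 1, 2} : Set ℕ), ∃ k : ℕ, 3 ≤ k ∧ m = x + n * k} ∪
          {1 + 2 * n}) ∧
    -- the example for `n = 2`
    (n = 2 → ∀ k : ℕ, 2 ≤ k →
      (symmetricIntegers k).Finite ∧
      moebiusStabilizer (symmetricIntegers k) = rotationGroup 2 ∧
      cyclicIndex 2 (symmetricIntegers k) = (1, k)) := by
  refine ⟨fun α hfin e => exists_unique_cyclicIndex hn hfin e,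
    fun ν k hν => table_of_stabilizer_mulEquiv hn hν, fun ν k hν => ⟨?_, ?_⟩, fun hn4 => ?_,
    fun hn23 => ?_, ?_⟩
  · rintro ⟨α, hfin, hα, hi⟩
    exact index_of_stabilizer_eq_rotationGroup hn hfin hα hν hi
  · exact exists_stabilizer_eq_rotationGroup hn hν
  · ext m
    refine (exists_ncard_eq_iff hn).trans ⟨?_, ?_⟩
    · rintro ⟨ν, k, hν, hk | ⟨rfl, rfl⟩ | ⟨-, rfl, rfl⟩, rfl⟩
      · exact Or.inl ⟨ν, by simp only [Set.mem_insert_iff, Set.mem_singleton_iff]; omega, k, hk, rfl⟩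
      · exact Or.inr (Or.inr (by rw [Set.mem_singleton_iff, mul_comm]))
      · exact Or.inr (Or.inl (by rw [mul_one]))
    · rintro (⟨x, hx, k, hk, rfl⟩ | rfl | rfl)
      · simp only [Set.mem_insert_iff, Set.mem_singleton_iff] at hx
        exact ⟨x, k, by omega, Or.inl hk, rfl⟩
      · exact ⟨1, 1, by omega, by omega, by rw [mul_one]⟩
      · exact ⟨1, 2, by omega, by omega, by rw [mul_comm]⟩
  · ext m
    refine (exists_ncard_eq_iff hn).trans ⟨?_, ?_⟩
    · rintro ⟨ν, k, hν, hk | ⟨rfl, rfl⟩ | ⟨hn4, -, -⟩, rfl⟩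
      · exact Or.inl ⟨ν, by simp only [Set.mem_insert_iff, Set.mem_singleton_iff]; omega, k, hk, rfl⟩
      · exact Or.inr (by rw [Set.mem_singleton_iff, mul_comm])
      · omega
    · rintro (⟨x, hx, k, hk, rfl⟩ | rfl)
      · simp only [Set.mem_insert_iff, Set.mem_singleton_iff] at hx
        exact ⟨x, k, by omega, Or.inl hk, rfl⟩
      · exact ⟨1, 2, by omega, by omega, by rw [mul_comm]⟩
  · rintro rfl k hk
    exact ⟨finite_symmetricIntegers k, stabilizer_symmetricIntegers hk,
      cyclicIndex_symmetricIntegers k⟩
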